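/- Let $n\ge 1$ and let $\mathcal K^n$ be the set of convex bodies (non-empty compact convex sets) in $\mathbb R^n$; let $B$ be the Euclidean unit ball of $\mathbb R^n$ and $\kappa_i$ the volume of the Euclidean unit ball of $\mathbb R^i$. For $K\in\mathcal K^n$ let $\mathrm W_i(K)$ be the quermassintegrals, given by the Steiner formula $\mathrm{vol}(K+tB)=\sum_{i=0}^n\binom ni \mathrm W_i(K)t^i$ for $t\ge0$, let $\mathrm V_i(K)=\binom ni\mathrm W_{n-i}(K)/\kappa_{n-i}$ be the intrinsic volumes, and let $\mathcal W(K)=\sum_{i=0}^n \mathrm V_i(K)$ be the Wills functional. For $K,E\in\mathcal K^n$ with $0\in\operatorname{int}E$ put $d_E(x,K)=\min\{t\ge0: x\in K+tE\}$, and for $u:[0,\infty)\to\mathbb R\cup\{\infty\}$ put $\mathcal W_u(K;E)=\int_{\mathbb R^n}e^{-u(d_E(x,K))}\,dx\in[0,\infty]$, where $e^{-\infty}=0$. (a) For all $K,L\in\mathcal K^n$ and $\lambda\in(0,1)$, $$\mathcal W\bigl((1-\lambda)K+\lambda L\bigr)^{1/n}\ \ge\ \frac1{(n!)^{1/n}}\Bigl((1-\lambda)\,\mathcal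 W(K)^{1/n}+\lambda\,\mathcal W(L)^{1/n}\Bigr).$$ (b) Let $u:[0,\infty)\to\mathbb R\cup\{\infty\}$ be convex and increasing, and continuous and strictly increasing on $\{t: u(t)\ne\infty\}$. Then for all $K,L,E\in\mathcal K^n$ with $0\in\operatorname{int}E$ and all $\lambda\in(0,1)$, $$\mathcal W_u\bigl((1-\lambda)K+\lambda L;E\bigr)^{1/n}\ \ge\ \frac{e^{-\frac{n-1}{n}\max\{u(0),0\}}}{(n!)^{1/n}}\Bigl((1-\lambda)\,\mathcal W_u(K;E)^{1/n}+\lambda\,\mathcal W_u(L;E)^{1/n}\Bigr).$$ -/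

import Mathlib

open MeasureTheory
open scoped NNReal ENNReal Nat

noncomputable section

namespace Wills

/-- The Euclidean space `ℝⁿ`. Convex bodies in it are the terms of `ConvexBody (Eucl n)`
(non-empty compact convex sets), with Minkowski addition `K + L` and dilatation `t • K`. -/
abbrev Eucl (n : ℕ) : Type := EuclideanSpace ℝ (Fin n)

/-- The closed Euclidean unit ball of `ℝⁿ` as a convex body. -/
def unitBall (n : ℕ) : ConvexBody (Eucl n) where
  carrier := Metric.closedBall 0 1
  convex' := convex_closedBall 0 1
  isCompact' := isCompact_closedBall 0 1
  nonempty' := ⟨0, Metric.mem_closedBall_self zero_le_one⟩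

/-- The volume of a convex body in `ℝⁿ`. -/
def vol {n : ℕ} (K : ConvexBody (Eucl n)) : ℝ := (volume : Measure (Eucl n)).real (K : Set (Eucl n))

/-- The volume `κ_n` of the Euclidean unit ball of `ℝⁿ`. -/
def kappa (n : ℕ) : ℝ := vol (unitBall n)

/-- `P` is a Steiner polynomial of `K` relative to `E`: it has degree at most `n` and
`vol (K + t E) = P(t)` for all `t ≥ 0`. -/
def IsSteinerPolynomial {n : ℕ} (K E : ConvexBody (Eucl n)) (P : Polynomial ℝ) : Prop :=
  P.natDegree ≤ n ∧ ∀ t : ℝ, 0 ≤ t → vol (K + t • E) = P.eval t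

/-- A Steiner polynomial is determined by the two bodies. -/
theorem IsSteinerPolynomial.unique {n : ℕ} {K E : ConvexBody (Eucl n)} {P Q : Polynomial ℝ}
    (hP : IsSteinerPolynomial K E P) (hQ : IsSteinerPolynomial K E Q) : P = Q := by
  refine Polynomial.eq_of_infinite_eval_eq P Q ((Set.Ici_infinite (0 : ℝ)).mono ?_)
  intro t ht
  exact (hP.2 t ht).symm.trans (hQ.2 t ht)

open Classical in
/-- The polynomial `t ↦ vol (K + t E)` on `[0, ∞)`. -/
def steinerPolynomial {n : ℕ} (K E : ConvexBody (Eucl n)) : Polynomial ℝ :=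
  if h : ∃ P, IsSteinerPolynomial K E P then h.choose else 0

/-- The relative quermassintegrals `W_i(K; E)`, read off from the Steiner formula
`vol (K + t E) = ∑ i ≤ n, (n choose i) W_i(K; E) t ^ i`. -/
def quermassintegral {n : ℕ} (K E : ConvexBody (Eucl n)) (i : ℕ) : ℝ :=
  (steinerPolynomial K E).coeff i / (n.choose i : ℝ)

/-- The intrinsic volumes `V_i(K) = (n choose i) W_{n-i}(K; B) / κ_{n-i}`, for `0 ≤ i ≤ n`. -/
def intrinsicVolume {n : ℕ} (K : ConvexBody (Eucl n)) (i : ℕ) : ℝ :=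
  (n.choose i : ℝ) / kappa (n - i) * quermassintegral K (unitBall n) (n - i)

/-- The classical Wills functional: the sum of the intrinsic volumes. -/
def wills {n : ℕ} (K : ConvexBody (Eucl n)) : ℝ :=
  ∑ i ∈ Finset.range (n + 1), intrinsicVolume K i

/-- The distance `d_E(x, K) = min {t ≥ 0 : x ∈ K + t E}` relative to a convex body `E`
with the origin in its interior. -/
def relDist {n : ℕ} (E K : ConvexBody (Eucl n)) (x : Eucl n) : ℝ≥0 :=
  sInf {t : ℝ≥0 | x ∈ K + (t : ℝ) • E}

/-- The class of increasing convex functions `u : [0, ∞) → ℝ ∪ {∞}` that are continuous on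
`{t | u t ≠ ∞}`. -/
structure IsWeight (u : ℝ≥0 → EReal) : Prop where
  ne_bot : ∀ t, u t ≠ ⊥
  monotone : Monotone u
  continuousOn : ContinuousOn u {t | u t ≠ ⊤}
  convex : ∀ s t a b : ℝ≥0, a + b = 1 →
    u (a * s + b * t) ≤ ((a : ℝ) : EReal) * u s + ((b : ℝ) : EReal) * u t

/-- The generalized Wills functional `W_u(K; E) = ∫ exp (-u (d_E(x, K))) dx`, where
`exp (-∞) = 0`. -/
def genWills {n : ℕ} (u : ℝ≥0 → EReal) (K E : ConvexBody (Eucl n)) : ℝ≥0∞ :=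
  ∫⁻ x : Eucl n, EReal.exp (-u (relDist E K x))

end Wills

end

/-! Let `u(0)` be finite and let `s` be a standard exponential variable. For `y ≥ u(0)` the number
`e^{-y}` is `e^{-u(0)}` times the probability of `y ≤ u(0) + s`, so Tonelli gives `W_u(K;E) =
e^{-u(0)} 𝔼[r_K(s)^n]`, where `r_K(s)` is the `n`-th root of the volume of `{x : u(d_E(x,K)) ≤ u(0)
+ s}`. Since `u` and `d_E` are convex, these sublevel sets combine with the bodies, and
Brunn–Minkowski (obtained from Prékopa–Leindler) gives `r_M ≥ (1-λ) r_K + λ r_L` for `M = (1-λ)K +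
λL`. So the means `𝔼 r` satisfy the desired inequality with constant 1.

Means and `n`-th moments are compared by `(𝔼 r)^n ≤ 𝔼 r^n ≤ n! (𝔼 r)^n`. The left half is Jensen.
The right half is of Berwald type: `r` is increasing with `r(ts) ≥ t r(s)` for `t ≤ 1`, so it
crosses the linear function of equal mean at most once, from above; linear functions are extremal
and `𝔼 s^n = n!`. This yields the bound with constant `(n!)^{-1/n}` alone, and the exponential
factor in (b) is at most 1.

Part (a) is the case `u(t) = πt²`, `E = B`, by Hadwiger's identity `W(K) = ∫ exp(-π d(x,K)²) dx`. It
rests on the Steiner formula, proved for polyhedra by splitting a tube according to the active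
constraints at the nearest point, and for all bodies by a decreasing polyhedral approximation. -/

/-! ### Brunn–Minkowski on the line -/

open Set Pointwise in
theorem IsCompact.volume_add_volume_le_volume_add {A B : Set ℝ} (hA : IsCompact A)
    (hB : IsCompact B) (hA' : A.Nonempty) (hB' : B.Nonempty) :
    volume A + volume B ≤ volume (A + B) := by
  obtain ⟨a, haA, ha⟩ := hA.exists_isGreatest hA'
  obtain ⟨b, hbB, hb⟩ := hB.exists_isLeast hB'
  have h1 : volume ((fun x => x + b) '' A) = volume A := by simp
  have h2 : volume ((fun x => a + x) '' B) = volume B := by simp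
  rw [← h1, ← h2, ← measure_union_add_inter (μ := volume) _
    (hB.image (by fun_prop)).measurableSet]
  -- As `a` is the maximum of `A` and `b` the minimum of `B`, the translate of `A` lies to the left
  -- of that of `B`.
  have h3 : ((fun x => x + b) '' A) ∩ ((fun x => a + x) '' B) ⊆ {a + b} := by
    rintro _ ⟨⟨x, hx, rfl⟩, ⟨y, hy, hxy⟩⟩
    have := ha hx
    have := hb hy
    simp only [mem_singleton_iff] at *
    linarith
  rw [measure_mono_null h3 (by simp), add_zero]
  apply measure_mono
  rintro _ (⟨x, hx, rfl⟩ | ⟨y, hy, rfl⟩)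
  · exact add_mem_add hx hbB
  · exact add_mem_add haA hy

open Set Pointwise in
theorem MeasurableSet.volume_add_volume_le_volume_add {A B : Set ℝ} (hA : MeasurableSet A)
    (hB : MeasurableSet B) (hA' : A.Nonempty) (hB' : B.Nonempty) :
    volume A + volume B ≤ volume (A + B) := by
  obtain ⟨a, ha⟩ := hA'
  obtain ⟨b, hb⟩ := hB'
  have key : ∀ S T : Set ℝ, S ⊆ A → IsCompact S → T ⊆ B → IsCompact T →
      volume S + volume T ≤ volume (A + B) := by
    intro S T hS hS' hT hT'
    -- The compact sets from inner regularity may be empty; adjoining `a` and `b` repairs this.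
    calc volume S + volume T ≤ volume (insert a S) + volume (insert b T) := by
          gcongr <;> apply subset_insert
      _ ≤ volume (insert a S + insert b T) :=
          (hS'.insert a).volume_add_volume_le_volume_add (hT'.insert b) (by simp) (by simp)
      _ ≤ _ := measure_mono (add_subset_add (insert_subset ha hS) (insert_subset hb hT))
  rw [hA.measure_eq_iSup_isCompact, hB.measure_eq_iSup_isCompact]
  simp only [iSup_and']
  exact ENNReal.biSup_add_biSup_le (s := {S | S ⊆ A ∧ IsCompact S})
    (t := {S | S ⊆ B ∧ IsCompact S}) ⟨∅, by simp⟩ ⟨∅, by simp⟩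
    fun S hS T hT => key S T hS.1 hS.2 hT.1 hT.2

/-! ### The Prékopa–Leindler inequality -/

/-- For `l ∈ (0, 1)`, the Prékopa–Leindler inequality holds for the measure `μ`. -/
def PrekopaLeindler {E : Type*} [AddCommGroup E] [Module ℝ E] [MeasurableSpace E]
    (μ : Measure E) (l : ℝ) : Prop :=
  ∀ f g h : E → ℝ≥0∞, Measurable f → Measurable g → Measurable h →
    (∀ x y, f x ^ (1 - l) * g y ^ l ≤ h ((1 - l) • x + l • y)) →
    (∫⁻ x, f x ∂μ) ^ (1 - l) * (∫⁻ x, g x ∂μ) ^ l ≤ ∫⁻ x, h x ∂μ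

namespace PrekopaLeindler

variable {E F : Type*} [AddCommGroup E] [Module ℝ E] [MeasurableSpace E]
  [AddCommGroup F] [Module ℝ F] [MeasurableSpace F] {μ : Measure E} {ν : Measure F} {l : ℝ}

/-- Applied on fibres, the inequality for `ν` is exactly the hypothesis on the partial integrals
that the inequality for `μ` needs. -/
theorem prod [SFinite ν] (hμ : PrekopaLeindler μ l) (hν : PrekopaLeindler ν l) :
    PrekopaLeindler (μ.prod ν) l := by
  intro f g h hf hg hh H
  rw [lintegral_prod _ hf.aemeasurable, lintegral_prod _ hg.aemeasurable,
    lintegral_prod _ hh.aemeasurable]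
  refine hμ _ _ _ hf.lintegral_prod_right' hg.lintegral_prod_right' hh.lintegral_prod_right'
    fun x y => ?_
  exact hν _ _ _ (by fun_prop) (by fun_prop) (by fun_prop) fun x' y' => H (x, x') (y, y')

theorem of_measurePreserving (hμ : PrekopaLeindler μ l) {e : E → F}
    (he : MeasurePreserving e μ ν)
    (he' : ∀ x y, e ((1 - l) • x + l • y) = (1 - l) • e x + l • e y) : PrekopaLeindler ν l := by
  intro f g h hf hg hh H
  rw [← he.lintegral_comp hf, ← he.lintegral_comp hg, ← he.lintegral_comp hh]
  refine hμ _ _ _ (hf.comp he.measurable) (hg.comp he.measurable) (hh.comp he.measurable)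
    fun x y => ?_
  simpa [he'] using H (e x) (e y)

end PrekopaLeindler

theorem lintegral_min_one_eq_lintegral_measure {E : Type*} [MeasurableSpace E] (μ : Measure E)
    [SFinite μ] {f : E → ℝ≥0∞} (hf : Measurable f) :
    ∫⁻ x, min (f x) 1 ∂μ = ∫⁻ t in Set.Ioo (0 : ℝ) 1, μ {x | ENNReal.ofReal t < f x} := by
  have hm : MeasurableSet {p : ℝ × E | ENNReal.ofReal p.1 < f p.2} :=
    measurableSet_lt (by fun_prop) (by fun_prop)
  have h1 : ∀ t : ℝ, μ {x | ENNReal.ofReal t < f x} =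
      ∫⁻ x, ({p : ℝ × E | ENNReal.ofReal p.1 < f p.2}.indicator 1 (t, x)) ∂μ := by
    intro t
    rw [← lintegral_indicator_one (measurableSet_lt (by fun_prop) (by fun_prop))]
    rfl
  simp_rw [h1]
  rw [lintegral_lintegral_swap]
  swap
  · exact ((measurable_one.indicator hm)).aemeasurable
  congr 1 with x
  have h2 : ∀ t : ℝ, ({p : ℝ × E | ENNReal.ofReal p.1 < f p.2}.indicator 1 (t, x) : ℝ≥0∞) =
    {t : ℝ | ENNReal.ofReal t < f x}.indicator 1 t := fun t => rfl
  simp_rw [h2]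
  rw [lintegral_indicator_one (measurableSet_lt (by fun_prop) (by fun_prop)),
    Measure.restrict_apply (measurableSet_lt (by fun_prop) (by fun_prop))]
  rcases le_total 1 (f x) with h | h
  · have : {t : ℝ | ENNReal.ofReal t < f x} ∩ Set.Ioo 0 1 = Set.Ioo 0 1 := by
      ext t
      simp only [Set.mem_inter_iff, Set.mem_ofPred_eq, Set.mem_Ioo, and_iff_right_iff_imp]
      rintro ⟨_, h1⟩
      exact lt_of_lt_of_le (by simpa using h1) h
    rw [this, min_eq_right h]
    simp
  · have hfx : f x ≠ ∞ := ne_top_of_le_ne_top ENNReal.one_ne_top h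
    have : {t : ℝ | ENNReal.ofReal t < f x} ∩ Set.Ioo 0 1 = Set.Ioo 0 (f x).toReal := by
      ext t
      have h' : (f x).toReal ≤ 1 := ENNReal.toReal_le_of_le_ofReal zero_le_one (by simpa using h)
      simp only [Set.mem_inter_iff, Set.mem_ofPred_eq, Set.mem_Ioo]
      constructor
      · rintro ⟨h1, h2, h3⟩
        exact ⟨h2, (ENNReal.ofReal_lt_iff_lt_toReal h2.le hfx).1 h1⟩
      · rintro ⟨h2, h1⟩
        exact ⟨(ENNReal.ofReal_lt_iff_lt_toReal h2.le hfx).2 h1, h2, h1.trans_le h'⟩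
    rw [this, min_eq_left h]
    simp [hfx]

open Set Pointwise in
theorem volume_combination_le {A B C : Set ℝ} {l : ℝ} (h0 : 0 < l) (h1 : l < 1)
    (hA : MeasurableSet A) (hB : MeasurableSet B) (hA' : A.Nonempty) (hB' : B.Nonempty)
    (hC : ∀ x ∈ A, ∀ y ∈ B, (1 - l) • x + l • y ∈ C) :
    ENNReal.ofReal (1 - l) * volume A + ENNReal.ofReal l * volume B ≤ volume C := by
  have h1' : 0 < 1 - l := by linarith
  calc _ = volume ((1 - l) • A) + volume (l • B) := by
        simp [Measure.addHaar_smul, abs_of_pos h0, abs_of_pos h1']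
    _ ≤ volume ((1 - l) • A + l • B) :=
        (hA.const_smul₀ _).volume_add_volume_le_volume_add (hB.const_smul₀ _)
          hA'.smul_set hB'.smul_set
    _ ≤ volume C := by
        apply measure_mono
        rintro _ ⟨_, ⟨x, hx, rfl⟩, _, ⟨y, hy, rfl⟩, rfl⟩
        exact hC x hx y hy

theorem ENNReal.rpow_mul_rpow_le_add {l : ℝ} (h0 : 0 < l) (h1 : l < 1) (a b : ℝ≥0∞) :
    a ^ (1 - l) * b ^ l ≤ ENNReal.ofReal (1 - l) * a + ENNReal.ofReal l * b := by
  have h1' : 0 < 1 - l := by linarith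
  have hpq : ((1 - l)⁻¹).HolderConjugate l⁻¹ := by
    rw [Real.holderConjugate_iff]
    exact ⟨(one_lt_inv₀ h1').2 (by linarith), by simp⟩
  have := ENNReal.young_inequality (a ^ (1 - l)) (b ^ l) hpq
  rwa [← ENNReal.rpow_mul, ← ENNReal.rpow_mul, mul_inv_cancel₀ h1'.ne', mul_inv_cancel₀ h0.ne',
    ENNReal.rpow_one, ENNReal.rpow_one, ENNReal.ofReal_inv_of_pos h1',
    ENNReal.ofReal_inv_of_pos h0, ENNReal.div_eq_inv_mul, ENNReal.div_eq_inv_mul, inv_inv,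
    inv_inv] at this

namespace PrekopaLeindler

/-- After scaling `f` and `g` to supremum 1, their level sets at every height `t < 1` are non-empty,
so one-dimensional Brunn–Minkowski applies level by level. Integrating over `t` gives an arithmetic
mean, which dominates the geometric one. -/
theorem real_of_bounded {l : ℝ} (h0 : 0 < l) (h1 : l < 1) {f g h : ℝ → ℝ≥0∞}
    (hf : Measurable f) (hg : Measurable g) (hh : Measurable h)
    (hF : ⨆ x, f x ≠ ∞) (hG : ⨆ x, g x ≠ ∞)
    (H : ∀ x y, f x ^ (1 - l) * g y ^ l ≤ h ((1 - l) • x + l • y)) :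
    (∫⁻ x, f x) ^ (1 - l) * (∫⁻ x, g x) ^ l ≤ ∫⁻ x, h x := by
  have h1' : 0 < 1 - l := by linarith
  rcases eq_or_ne (⨆ x, f x) 0 with hF0 | hF0
  · simp only [ENNReal.iSup_eq_zero] at hF0
    simp [hF0, h1']
  rcases eq_or_ne (⨆ x, g x) 0 with hG0 | hG0
  · simp only [ENNReal.iSup_eq_zero] at hG0
    simp [hG0, h0]
  set F := ⨆ x, f x with hFdef
  set G := ⨆ x, g x with hGdef
  set c := F ^ (1 - l) * G ^ l with hc
  have hc0 : c ≠ 0 := by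
    simp [hc, hF0, hG0, hF, hG]
  have hct : c ≠ ∞ := ENNReal.mul_ne_top (by simp [hF0, hF]) (by simp [hG0, hG])
  have nonempty_of : ∀ {k : ℝ → ℝ≥0∞}, (⨆ x, k x) ≠ ∞ → (⨆ x, k x) ≠ 0 → ∀ t ∈ Set.Ioo (0 : ℝ) 1,
      {x | ENNReal.ofReal t < k x * (⨆ x, k x)⁻¹}.Nonempty := by
    intro k hk hk0 t ht
    have : ENNReal.ofReal t * (⨆ x, k x) < ⨆ x, k x := by
      conv_rhs => rw [← one_mul (⨆ x, k x)]
      rw [ENNReal.mul_lt_mul_iff_left hk0 hk]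
      simpa using ht.2
    obtain ⟨x, hx⟩ := lt_iSup_iff.1 this
    refine ⟨x, ?_⟩
    rw [Set.mem_ofPred_eq, ← div_eq_mul_inv]
    exact (ENNReal.lt_div_iff_mul_lt (Or.inl hk0) (Or.inl hk)).2 hx
  have main : ENNReal.ofReal (1 - l) * (∫⁻ x, f x * F⁻¹) + ENNReal.ofReal l * (∫⁻ x, g x * G⁻¹) ≤
      ∫⁻ x, h x * c⁻¹ := by
    have e : ∀ {k : ℝ → ℝ≥0∞}, ⨆ x, k x ≠ ∞ → (⨆ x, k x) ≠ 0 → Measurable k →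
        ∫⁻ x, k x * (⨆ x, k x)⁻¹ = ∫⁻ t in Set.Ioo (0 : ℝ) 1,
          volume {x | ENNReal.ofReal t < k x * (⨆ x, k x)⁻¹} := by
      intro k hk hk0 hkm
      rw [← lintegral_min_one_eq_lintegral_measure _ (hkm.mul_const _)]
      congr 1 with x
      rw [min_eq_left]
      rw [← div_eq_mul_inv]
      exact ENNReal.div_le_of_le_mul (by simpa using le_iSup k x)
    rw [e hF hF0 hf, e hG hG0 hg]
    calc _ = ∫⁻ t in Set.Ioo (0 : ℝ) 1,
          (ENNReal.ofReal (1 - l) * volume {x | ENNReal.ofReal t < f x * F⁻¹}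
          + ENNReal.ofReal l * volume {x | ENNReal.ofReal t < g x * G⁻¹}) := by
          have hmeas : ∀ {k : ℝ → ℝ≥0∞}, Measurable fun t : ℝ =>
              volume {x : ℝ | ENNReal.ofReal t < k x} := fun {k} =>
            Antitone.measurable fun s t hst => measure_mono fun x hx =>
              lt_of_le_of_lt (ENNReal.ofReal_le_ofReal hst) hx
          rw [lintegral_add_left (hmeas.const_mul _), lintegral_const_mul _ hmeas,
            lintegral_const_mul _ hmeas]
      _ ≤ ∫⁻ t in Set.Ioo (0 : ℝ) 1, volume {x | ENNReal.ofReal t < h x * c⁻¹} := by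
          refine setLIntegral_mono' measurableSet_Ioo fun t ht => ?_
          refine volume_combination_le h0 h1 (measurableSet_lt (by fun_prop) (by fun_prop))
            (measurableSet_lt (by fun_prop) (by fun_prop)) (nonempty_of hF hF0 t ht)
            (nonempty_of hG hG0 t ht) fun x hx y hy => ?_
          simp only [Set.mem_ofPred_eq] at hx hy ⊢
          have ht0 : ENNReal.ofReal t ≠ 0 := by simpa using ht.1
          calc ENNReal.ofReal t = ENNReal.ofReal t ^ (1 - l) * ENNReal.ofReal t ^ l := by
                rw [← ENNReal.rpow_add _ _ ht0 (by simp)]; simp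
            _ < (f x * F⁻¹) ^ (1 - l) * (g y * G⁻¹) ^ l :=
                ENNReal.mul_lt_mul (ENNReal.rpow_lt_rpow hx h1') (ENNReal.rpow_lt_rpow hy h0)
            _ = (f x ^ (1 - l) * g y ^ l) * c⁻¹ := by
                rw [ENNReal.mul_rpow_of_nonneg _ _ h1'.le, ENNReal.mul_rpow_of_nonneg _ _ h0.le, hc,
                  ENNReal.mul_inv (by simp [hF0, hF]) (by simp [hF0, hF]),
                  ENNReal.inv_rpow, ENNReal.inv_rpow]
                ring
            _ ≤ _ := by gcongr; exact H x y
      _ = ∫⁻ x, min (h x * c⁻¹) 1 :=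
          (lintegral_min_one_eq_lintegral_measure _ (hh.mul_const _)).symm
      _ ≤ _ := lintegral_mono fun x => min_le_left _ _
  rw [lintegral_mul_const _ hf, lintegral_mul_const _ hg, lintegral_mul_const _ hh] at main
  have := (ENNReal.rpow_mul_rpow_le_add h0 h1 _ _).trans main
  rw [ENNReal.mul_rpow_of_nonneg _ _ h1'.le, ENNReal.mul_rpow_of_nonneg _ _ h0.le,
    ENNReal.inv_rpow, ENNReal.inv_rpow, mul_mul_mul_comm,
    ← ENNReal.mul_inv (by simp [hF0, hF]) (by simp [hF0, hF]), ← hc] at this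
  exact (ENNReal.mul_le_mul_iff_left (by simpa using hct) (by simpa using hc0)).1 this

theorem lintegral_eq_iSup_lintegral_min {E : Type*} [MeasurableSpace E] (μ : Measure E)
    {f : E → ℝ≥0∞} (hf : Measurable f) :
    ∫⁻ x, f x ∂μ = ⨆ N : ℕ, ∫⁻ x, min (f x) N ∂μ := by
  rw [← lintegral_iSup (fun N => hf.min measurable_const)]
  · congr 1 with x
    rw [← inf_iSup_eq, ENNReal.iSup_natCast, inf_top_eq]
  · intro m n hmn x
    exact min_le_min_left _ (by exact_mod_cast hmn)

theorem real {l : ℝ} (h0 : 0 < l) (h1 : l < 1) : PrekopaLeindler (volume : Measure ℝ) l := by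
  intro f g h hf hg hh H
  have h1' : 0 < 1 - l := by linarith
  rw [lintegral_eq_iSup_lintegral_min _ hf, lintegral_eq_iSup_lintegral_min _ hg]
  have e : ∀ {p : ℝ} (hp : 0 < p) (k : ℕ → ℝ≥0∞), (⨆ N, k N) ^ p = ⨆ N, k N ^ p := fun hp k =>
    (ENNReal.orderIsoRpow _ hp).map_iSup k
  rw [e h1', e h0]
  simp only [ENNReal.iSup_mul, ENNReal.mul_iSup, iSup_le_iff]
  intro N M
  have hb : ∀ (k : ℝ → ℝ≥0∞) (m : ℕ), ⨆ x, min (k x) (m : ℝ≥0∞) ≠ ∞ := fun k m =>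
    ne_top_of_le_ne_top (ENNReal.natCast_ne_top m) (iSup_le fun x => min_le_right _ _)
  refine real_of_bounded h0 h1 (hf.min measurable_const) (hg.min measurable_const) hh
    (hb _ _) (hb _ _) fun x y => le_trans ?_ (H x y)
  gcongr <;> exact min_le_left _ _

theorem pi {l : ℝ} (h0 : 0 < l) (h1 : l < 1) (n : ℕ) :
    PrekopaLeindler (volume : Measure (Fin n → ℝ)) l := by
  induction n with
  | zero =>
    intro f g h hf hg hh H
    have hv : (volume : Measure (Fin 0 → ℝ)) = Measure.dirac 0 := by
      rw [volume_pi, Measure.pi_of_empty (x := 0)]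
    rw [hv, lintegral_dirac' _ hf, lintegral_dirac' _ hg, lintegral_dirac' _ hh]
    simpa using H 0 0
  | succ n ih =>
    have := (real h0 h1).prod ih
    refine this.of_measurePreserving (F := Fin (n + 1) → ℝ)
      (MeasurePreserving.symm _ (volume_preserving_piFinSuccAbove (fun _ => ℝ) 0)) ?_
    intro x y
    ext i
    refine Fin.cases ?_ (fun i => ?_) i <;> simp [MeasurableEquiv.piFinSuccAbove]

theorem euclideanSpace {l : ℝ} (h0 : 0 < l) (h1 : l < 1) (n : ℕ) :
    PrekopaLeindler (volume : Measure (EuclideanSpace ℝ (Fin n))) l :=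
  (pi h0 h1 n).of_measurePreserving (PiLp.volume_preserving_toLp (Fin n)) fun _ _ => rfl

theorem measure_rpow_mul_le {E : Type*} [AddCommGroup E] [Module ℝ E] [MeasurableSpace E]
    {μ : Measure E} {l : ℝ} (h0 : 0 < l) (h1 : l < 1) (hμ : PrekopaLeindler μ l) {A B C : Set E}
    (hA : MeasurableSet A) (hB : MeasurableSet B) (hC : MeasurableSet C)
    (H : ∀ x ∈ A, ∀ y ∈ B, (1 - l) • x + l • y ∈ C) :
    μ A ^ (1 - l) * μ B ^ l ≤ μ C := by
  have h1' : 0 < 1 - l := by linarith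
  have := hμ (A.indicator 1) (B.indicator 1) (C.indicator 1) (measurable_one.indicator hA)
    (measurable_one.indicator hB) (measurable_one.indicator hC) fun x y => by
      by_cases hx : x ∈ A <;> by_cases hy : y ∈ B <;> simp [hx, hy, h0, h1']
      simp [H x hx y hy]
  rwa [lintegral_indicator_one hA, lintegral_indicator_one hB, lintegral_indicator_one hC] at this

end PrekopaLeindler

/-! ### Brunn–Minkowski in Euclidean space -/

section BrunnMinkowski

open Set Pointwise

variable {n : ℕ} {A B C : Set (EuclideanSpace ℝ (Fin n))}

theorem ofReal_mul_volume_rpow_le (hn : n ≠ 0) {r : ℝ} (hr : 0 ≤ r)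
    (c : EuclideanSpace ℝ (Fin n)) (H : ∀ x ∈ A, c + r • x ∈ C) :
    ENNReal.ofReal r * volume A ^ (1 / (n : ℝ)) ≤ volume C ^ (1 / (n : ℝ)) := by
  have hn' : (0 : ℝ) < n := by positivity
  have h : volume ((fun x => c + x) '' (r • A)) ≤ volume C := by
    apply measure_mono
    rintro _ ⟨_, ⟨x, hx, rfl⟩, rfl⟩
    exact H x hx
  rw [image_add_left, measure_preimage_add, Measure.addHaar_smul, finrank_euclideanSpace_fin,
    abs_of_nonneg (by positivity), ENNReal.ofReal_pow hr] at h
  have := ENNReal.rpow_le_rpow h (z := 1 / (n : ℝ)) (by positivity)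
  rwa [ENNReal.mul_rpow_of_nonneg _ _ (by positivity), ← ENNReal.rpow_natCast, ← ENNReal.rpow_mul,
    mul_one_div_cancel hn'.ne', ENNReal.rpow_one] at this

/-- The Brunn–Minkowski inequality for measurable sets. -/
theorem brunnMinkowski (hn : n ≠ 0) {l : ℝ} (h0 : 0 < l) (h1 : l < 1)
    (hA : MeasurableSet A) (hB : MeasurableSet B) (hC : MeasurableSet C)
    (hA' : A.Nonempty) (hB' : B.Nonempty)
    (H : ∀ x ∈ A, ∀ y ∈ B, (1 - l) • x + l • y ∈ C) :
    ENNReal.ofReal (1 - l) * volume A ^ (1 / (n : ℝ)) +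
      ENNReal.ofReal l * volume B ^ (1 / (n : ℝ)) ≤ volume C ^ (1 / (n : ℝ)) := by
  have hn' : (0 : ℝ) < n := by positivity
  have hn1 : (0 : ℝ) < 1 / n := by positivity
  have h1' : 0 < 1 - l := by linarith
  obtain ⟨x₀, hx₀⟩ := hA'
  obtain ⟨y₀, hy₀⟩ := hB'
  have HA := ofReal_mul_volume_rpow_le (A := A) (C := C) hn h1'.le (l • y₀)
    fun x hx => by rw [add_comm]; exact H x hx y₀ hy₀
  have HB := ofReal_mul_volume_rpow_le (A := B) (C := C) hn h0.le ((1 - l) • x₀)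
    fun y hy => H x₀ hx₀ y hy
  -- If one volume is zero or infinite, a translated dilate of a single set inside `C` suffices.
  rcases eq_or_ne (volume A) 0 with hA0 | hA0
  · simpa [hA0, hn', hn1] using HB
  rcases eq_or_ne (volume B) 0 with hB0 | hB0
  · simpa [hB0, hn', hn1] using HA
  rcases eq_or_ne (volume A) ∞ with hAt | hAt
  · rw [hAt, ENNReal.top_rpow_of_pos hn1, ENNReal.mul_top (by simpa using h1)] at HA
    rw [top_le_iff.1 HA]
    exact le_top
  rcases eq_or_ne (volume B) ∞ with hBt | hBt
  · rw [hBt, ENNReal.top_rpow_of_pos hn1, ENNReal.mul_top (by simpa using h0)] at HB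
    rw [top_le_iff.1 HB]
    exact le_top
  have root : ∀ {S : Set (EuclideanSpace ℝ (Fin n))}, volume S ≠ 0 → volume S ≠ ∞ →
      ∃ a : ℝ, 0 < a ∧ volume S ^ (1 / (n : ℝ)) = ENNReal.ofReal a ∧ volume (a⁻¹ • S) = 1 := by
    intro S hS0 hSt
    have ht : volume S ^ (1 / (n : ℝ)) ≠ ∞ := ENNReal.rpow_ne_top_of_nonneg hn1.le hSt
    have ha : 0 < (volume S ^ (1 / (n : ℝ))).toReal :=
      ENNReal.toReal_pos (by simp [hS0, hSt]) ht
    refine ⟨_, ha, (ENNReal.ofReal_toReal ht).symm, ?_⟩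
    rw [Measure.addHaar_smul, finrank_euclideanSpace_fin, abs_of_nonneg (by positivity),
      ENNReal.ofReal_pow (by positivity), ENNReal.ofReal_inv_of_pos ha, ENNReal.ofReal_toReal ht,
      ← ENNReal.inv_pow, ← ENNReal.rpow_natCast, ← ENNReal.rpow_mul, one_div_mul_cancel hn'.ne',
      ENNReal.rpow_one, ENNReal.inv_mul_cancel hS0 hSt]
  obtain ⟨a, ha, hAa, hA1⟩ := root hA0 hAt
  obtain ⟨b, hb, hBb, hB1⟩ := root hB0 hBt
  have hr : 0 < (1 - l) * a + l * b := by positivity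
  set r := (1 - l) * a + l * b with hrdef
  -- With weight `m = l b / r` one has `(1 - m) x/a + m y/b = ((1 - l) x + l y)/r`, so the
  -- multiplicative inequality for the unit-volume sets `A/a`, `B/b` shows that `C/r` has volume at
  -- least 1.
  have hm0 : 0 < l * b / r := by positivity
  have hm1 : l * b / r < 1 := by
    rw [div_lt_one hr, hrdef]
    have : 0 < (1 - l) * a := by positivity
    linarith
  have key := (PrekopaLeindler.euclideanSpace hm0 hm1 n).measure_rpow_mul_le hm0 hm1
    (hA.const_smul₀ a⁻¹) (hB.const_smul₀ b⁻¹) (hC.const_smul₀ r⁻¹) (by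
      rintro _ ⟨x, hx, rfl⟩ _ ⟨y, hy, rfl⟩
      refine ⟨_, H x hx y hy, ?_⟩
      simp only [smul_add, smul_smul]
      congr 2
      · rw [hrdef]; field_simp; ring
      · field_simp)
  rw [hA1, hB1, ENNReal.one_rpow, ENNReal.one_rpow, one_mul] at key
  have := ofReal_mul_volume_rpow_le (A := r⁻¹ • C) (C := C) hn hr.le 0 (by
    rintro _ ⟨x, hx, rfl⟩
    simpa [smul_smul, hr.ne'] using hx)
  rw [hAa, hBb, ← ENNReal.ofReal_mul h1'.le, ← ENNReal.ofReal_mul h0.le,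
    ← ENNReal.ofReal_add (by positivity) (by positivity), ← hrdef]
  refine le_trans ?_ this
  conv_lhs => rw [← mul_one (ENNReal.ofReal r)]
  gcongr
  calc (1 : ℝ≥0∞) = 1 ^ (1 / (n : ℝ)) := by simp
    _ ≤ _ := by gcongr

end BrunnMinkowski

/-! ### Reverse Jensen inequality for the exponential distribution -/

/-- If `A ≥ a`, `B ≥ b` and `a ≥ b`, or all three are reversed, the difference of the `n`-th powers
is controlled by the slope at `(A, B)`. -/
theorem pow_add_geom_sum_mul_le {a b A B : ℝ≥0} (n : ℕ)
    (h : (b ≤ a ∧ a ≤ A ∧ b ≤ B) ∨ (a ≤ b ∧ A ≤ a ∧ B ≤ b)) :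
    a ^ n + (∑ i ∈ Finset.range n, A ^ i * B ^ (n - 1 - i)) * b ≤
      b ^ n + (∑ i ∈ Finset.range n, A ^ i * B ^ (n - 1 - i)) * a := by
  rw [← NNReal.coe_le_coe]
  push_cast
  have e := (Commute.all (a : ℝ) b).geom_sum₂_mul n
  rcases h with ⟨h1, h2, h3⟩ | ⟨h1, h2, h3⟩
  · have : (∑ i ∈ Finset.range n, (a : ℝ) ^ i * (b : ℝ) ^ (n - 1 - i)) ≤
      ∑ i ∈ Finset.range n, (A : ℝ) ^ i * (B : ℝ) ^ (n - 1 - i) := by gcongr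
    have h1' : (b : ℝ) ≤ a := h1
    nlinarith
  · have : (∑ i ∈ Finset.range n, (A : ℝ) ^ i * (B : ℝ) ^ (n - 1 - i)) ≤
      ∑ i ∈ Finset.range n, (a : ℝ) ^ i * (b : ℝ) ^ (n - 1 - i) := by gcongr
    have h1' : (a : ℝ) ≤ b := h1
    nlinarith

/-- The standard exponential distribution on `[0, ∞)`. -/
noncomputable def stdExp : Measure ℝ≥0 :=
  ((volume.restrict (Set.Ioi (0 : ℝ))).withDensity
    fun s => ENNReal.ofReal (Real.exp (-s))).map Real.toNNReal

theorem lintegral_stdExp {f : ℝ≥0 → ℝ≥0∞} (hf : Measurable f) :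
    ∫⁻ s, f s ∂stdExp =
      ∫⁻ s in Set.Ioi (0 : ℝ), ENNReal.ofReal (Real.exp (-s)) * f s.toNNReal := by
  rw [stdExp, lintegral_map hf (by fun_prop),
    lintegral_withDensity_eq_lintegral_mul _ (by fun_prop) (by fun_prop)]
  rfl

theorem lintegral_rpow_stdExp {p : ℝ} (hp : 0 ≤ p) :
    ∫⁻ s : ℝ≥0, ENNReal.ofReal ((s : ℝ) ^ p) ∂stdExp = ENNReal.ofReal (Real.Gamma (p + 1)) := by
  rw [lintegral_stdExp (by fun_prop), Real.Gamma_eq_integral (by positivity),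
    ofReal_integral_eq_lintegral_ofReal (Real.GammaIntegral_convergent (by positivity))]
  · refine setLIntegral_congr_fun measurableSet_Ioi fun s hs => ?_
    rw [← ENNReal.ofReal_mul (by positivity), Real.coe_toNNReal _ (le_of_lt hs), add_sub_cancel_right]
  · filter_upwards [ae_restrict_mem measurableSet_Ioi] with s hs
    have : (0 : ℝ) < s := hs
    positivity

theorem lintegral_pow_stdExp (n : ℕ) : ∫⁻ s, (s : ℝ≥0∞) ^ n ∂stdExp = n ! := by
  have := lintegral_rpow_stdExp (Nat.cast_nonneg n)
  rw [Real.Gamma_nat_eq_factorial, ENNReal.ofReal_natCast] at this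
  rw [← this]
  congr 1 with s
  rw [Real.rpow_natCast, ENNReal.ofReal_pow (by positivity), ENNReal.ofReal_coe_nnreal]

theorem stdExp_Ici (s : ℝ≥0) : stdExp (Set.Ici s) = ENNReal.ofReal (Real.exp (-s)) := by
  rw [← lintegral_indicator_one measurableSet_Ici,
    lintegral_stdExp (measurable_one.indicator measurableSet_Ici), ← integral_exp_neg_Ioi,
    ofReal_integral_eq_lintegral_ofReal (integrableOn_exp_neg_Ioi _)
      (Filter.Eventually.of_forall fun s => (Real.exp_pos _).le)]
  have : ∀ t : ℝ, t ∈ Set.Ioi (0 : ℝ) → ENNReal.ofReal (Real.exp (-t)) *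
      (Set.Ici s).indicator 1 t.toNNReal =
      (Set.Ici (s : ℝ)).indicator (fun t => ENNReal.ofReal (Real.exp (-t))) t := by
    intro t ht
    by_cases h : (s : ℝ) ≤ t
    · have h' : s ≤ t.toNNReal := NNReal.le_toNNReal_of_coe_le h
      simp [h, h']
    · have h' : ¬ s ≤ t.toNNReal := by
        rwa [← NNReal.coe_le_coe, Real.coe_toNNReal _ (le_of_lt ht)]
      simp [h, h']
  rw [setLIntegral_congr_fun measurableSet_Ioi this, lintegral_indicator measurableSet_Ici,
    Measure.restrict_restrict measurableSet_Ici]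
  have e : Set.Ioi (s : ℝ) = Set.Ioi (s : ℝ) ∩ Set.Ioi 0 :=
    (Set.inter_eq_left.2 (Set.Ioi_subset_Ioi s.2)).symm
  conv_rhs => rw [e]
  exact setLIntegral_congr (Ioi_ae_eq_Ici.symm.inter (Filter.EventuallyEq.refl _ _))

instance : IsProbabilityMeasure stdExp := by
  constructor
  simpa using lintegral_pow_stdExp 0

/-- A reverse Jensen inequality of Berwald type for the exponential distribution. -/
theorem lintegral_pow_le_factorial_mul {f : ℝ≥0 → ℝ≥0∞} (hm : Monotone f)
    (hs : ∀ t s : ℝ≥0, t ≤ 1 → t * f s ≤ f (t * s)) (n : ℕ) (hn : n ≠ 0) :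
    ∫⁻ s, f s ^ n ∂stdExp ≤ n ! * (∫⁻ s, f s ∂stdExp) ^ n := by
  set C := ∫⁻ s, f s ∂stdExp with hC
  rcases eq_or_ne C ∞ with hCt | hCt
  · simp [hCt, hn, Nat.factorial_ne_zero]
  lift C to ℝ≥0 using hCt with c
  -- An infinite value would persist on a half-line of positive mass and make the mean infinite.
  have hfin : ∀ s, f s ≠ ∞ := by
    intro s hs'
    have : (∞ : ℝ≥0∞) * stdExp (Set.Ici s) ≤ ∫⁻ s, f s ∂stdExp := by
      rw [← lintegral_indicator_const measurableSet_Ici]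
      refine lintegral_mono fun t => ?_
      by_cases h : t ∈ Set.Ici s
      · simp only [h, Set.indicator_of_mem, top_le_iff]
        exact top_le_iff.1 (hs' ▸ hm h)
      · simp [h]
    have hpos : stdExp (Set.Ici s) ≠ 0 := by
      rw [stdExp_Ici]
      simp [Real.exp_pos]
    rw [ENNReal.top_mul hpos, ← hC] at this
    simp at this
  lift f to ℝ≥0 → ℝ≥0 using hfin
  have hm' : Monotone f := fun s t h => ENNReal.coe_le_coe.1 (hm h)
  have hs' : ∀ t s : ℝ≥0, t ≤ 1 → t * f s ≤ f (t * s) := fun t s h => by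
    have := hs t s h
    rwa [← ENNReal.coe_mul, ENNReal.coe_le_coe] at this
  have hψ : ∫⁻ s, ((c * s : ℝ≥0) : ℝ≥0∞) ∂stdExp = c := by
    simp only [ENNReal.coe_mul]
    rw [lintegral_const_mul _ (by fun_prop)]
    simpa using congrArg (fun x => (c : ℝ≥0∞) * x) (lintegral_pow_stdExp 1)
  have hψn : ∫⁻ s, ((c * s : ℝ≥0) : ℝ≥0∞) ^ n ∂stdExp = n ! * c ^ n := by
    simp only [ENNReal.coe_mul, mul_pow]
    rw [lintegral_const_mul _ (by fun_prop), lintegral_pow_stdExp, mul_comm]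
  rw [← hψn]
  -- The comparison function `c * s` has the mean of `f`. Since `f s / s` is non-increasing, the set
  -- where `c * s ≤ f s` is an initial interval, so there is at most one crossing.
  have below : ∀ s t, s ≤ t → c * t ≤ f t → c * s ≤ f s := by
    intro s t hst h
    rcases eq_or_ne t 0 with rfl | ht
    · simp [nonpos_iff_eq_zero.1 hst]
    calc c * s = (s / t) * (c * t) := by field_simp
      _ ≤ (s / t) * f t := by gcongr
      _ ≤ f (s / t * t) := hs' _ _ (div_le_one_of_le₀ hst (by simp))
      _ = f s := by rw [div_mul_cancel₀ _ ht]
  have hfm : Measurable f := hm'.measurable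
  by_cases hub : ∀ s, c * s ≤ f s
  · have : (fun s => ((c * s : ℝ≥0) : ℝ≥0∞)) =ᵐ[stdExp] fun s => (f s : ℝ≥0∞) := by
      apply ae_eq_of_ae_le_of_lintegral_le
      · exact Filter.Eventually.of_forall fun s => ENNReal.coe_le_coe.2 (hub s)
      · rw [hψ]; simp
      · fun_prop
      · rw [hψ, ← hC]
    refine (lintegral_congr_ae ?_).le
    filter_upwards [this] with s hs
    rw [hs]
  · push Not at hub
    obtain ⟨T, hT⟩ := hub
    have hbdd : BddAbove {s | c * s ≤ f s} := ⟨T, fun s hs => by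
      by_contra! h
      exact absurd (below T s h.le hs) (not_le.2 hT)⟩
    set s₀ := sSup {s | c * s ≤ f s} with hs₀
    -- Slope of the `n`-th power between the two values at the crossing `s₀`. The bound `f^n - (c
    -- s)^n ≤ q (f - c s)` then holds on both sides of `s₀`, and its right side integrates to zero.
    -- Keeping both values avoids showing `f s₀ = c * s₀`.
    set q : ℝ≥0 := ∑ i ∈ Finset.range n, f s₀ ^ i * (c * s₀) ^ (n - 1 - i) with hq
    have key : ∀ s, f s ^ n + q * (c * s) ≤ (c * s) ^ n + q * f s := by
      intro s
      rcases lt_trichotomy s s₀ with h | h | h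
      · obtain ⟨t, ht, hst⟩ := exists_lt_of_lt_csSup ⟨0, by simp⟩ h
        exact pow_add_geom_sum_mul_le n
          (Or.inl ⟨below s t hst.le ht, hm' h.le, by gcongr⟩)
      · rw [h]
        rcases le_total (f s₀) (c * s₀) with h | h
        · exact pow_add_geom_sum_mul_le n (Or.inr ⟨h, le_rfl, le_rfl⟩)
        · exact pow_add_geom_sum_mul_le n (Or.inl ⟨h, le_rfl, le_rfl⟩)
      · refine pow_add_geom_sum_mul_le n (Or.inr ⟨?_, hm' h.le, by gcongr⟩)
        by_contra! h'
        exact absurd (le_csSup hbdd h'.le) (not_le.2 h)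
    have : ∫⁻ s, ((f s : ℝ≥0∞) ^ n + q * ((c * s : ℝ≥0) : ℝ≥0∞)) ∂stdExp ≤
        ∫⁻ s, (((c * s : ℝ≥0) : ℝ≥0∞) ^ n + q * (f s : ℝ≥0∞)) ∂stdExp :=
      lintegral_mono fun s => by
        have := ENNReal.coe_le_coe.2 (key s)
        push_cast at this ⊢
        exact this
    rw [lintegral_add_right _ (by fun_prop), lintegral_add_right _ (by fun_prop),
      lintegral_const_mul _ (by fun_prop), lintegral_const_mul _ (by fun_prop), hψ, ← hC] at this
    exact (ENNReal.add_le_add_iff_right (by finiteness)).1 this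

/-! ### Distance relative to a convex body -/

namespace Wills

section RelDist

open Pointwise Set

variable {n : ℕ} {E K L M : ConvexBody (Eucl n)}

theorem mem_add_smul_iff {x : Eucl n} {t : ℝ} :
    x ∈ K + t • E ↔ ∃ k ∈ K, ∃ e ∈ E, x = k + t • e := by
  rw [← SetLike.mem_coe, ConvexBody.coe_add, ConvexBody.coe_smul]
  constructor
  · rintro ⟨k, hk, _, ⟨e, he, rfl⟩, rfl⟩
    exact ⟨k, hk, e, he, rfl⟩
  · rintro ⟨k, hk, e, he, rfl⟩
    exact ⟨k, hk, _, ⟨e, he, rfl⟩, rfl⟩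

theorem isClosed_setOf_mem_add_smul (E K : ConvexBody (Eucl n)) (x : Eucl n) :
    IsClosed {t : ℝ≥0 | x ∈ K + (t : ℝ) • E} := by
  have : CompactSpace K := isCompact_iff_compactSpace.1 K.isCompact
  have : CompactSpace E := isCompact_iff_compactSpace.1 E.isCompact
  have h : IsClosed {p : ℝ≥0 × (K × E) |
      x = (p.2.1 : Eucl n) + (p.1 : ℝ) • (p.2.2 : Eucl n)} :=
    isClosed_eq (by fun_prop) (by fun_prop)
  convert isClosedMap_fst_of_compactSpace _ h using 1
  ext t
  simp only [mem_ofPred_eq, mem_add_smul_iff, mem_image, Prod.exists, Subtype.exists]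
  constructor
  · rintro ⟨k, hk, e, he, h⟩
    exact ⟨t, k, hk, e, he, h, rfl⟩
  · rintro ⟨t, k, hk, e, he, h, rfl⟩
    exact ⟨k, hk, e, he, h⟩

/-- The infimum is attained because the admissible `t` form a closed non-empty set, and `K + tE`
grows with `t` because `0 ∈ E`. -/
theorem relDist_le_iff (hE : (0 : Eucl n) ∈ interior (E : Set (Eucl n))) {x : Eucl n} {t : ℝ≥0} :
    relDist E K x ≤ t ↔ x ∈ K + (t : ℝ) • E := by
  have h0 : (0 : Eucl n) ∈ (E : Set (Eucl n)) := interior_subset hE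
  constructor
  · intro h
    -- Needed because the infimum of the empty set is `0` in `ℝ≥0`. Small multiples of `x - k` lie
    -- in `E`, a neighbourhood of the origin.
    have hne : {t : ℝ≥0 | x ∈ K + (t : ℝ) • E}.Nonempty := by
      obtain ⟨k, hk⟩ := K.nonempty
      have : Filter.Tendsto (fun s : ℝ => s • (x - k)) (nhdsWithin 0 (Ioi 0)) (nhds 0) := by
        have : ContinuousAt (fun s : ℝ => s • (x - k)) 0 := by fun_prop
        simpa [ContinuousAt] using this.tendsto.mono_left nhdsWithin_le_nhds
      obtain ⟨s, hs, hs0⟩ := ((this.eventually (mem_interior_iff_mem_nhds.1 hE)).and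
        self_mem_nhdsWithin).exists
      have hs0' : (0 : ℝ) < s := hs0
      refine ⟨NNReal.mk s⁻¹ (by positivity), mem_add_smul_iff.2 ⟨k, hk, s • (x - k), hs, ?_⟩⟩
      rw [smul_smul, NNReal.coe_mk, inv_mul_cancel₀ hs0'.ne', one_smul, add_sub_cancel]
    have hm := (isClosed_setOf_mem_add_smul E K x).csInf_mem hne (OrderBot.bddBelow _)
    obtain ⟨k, hk, e, he, hx⟩ := mem_add_smul_iff.1 hm
    change relDist E K x ≤ t at h
    rw [← relDist] at hx
    rcases eq_or_ne t 0 with rfl | ht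
    · rw [nonpos_iff_eq_zero.1 h] at hx
      exact mem_add_smul_iff.2 ⟨k, hk, e, he, hx⟩
    · have ht' : (t : ℝ) ≠ 0 := by exact_mod_cast ht
      refine mem_add_smul_iff.2 ⟨k, hk, ((relDist E K x : ℝ) / t) • e, ?_, ?_⟩
      · refine E.convex.smul_mem_of_zero_mem h0 he ⟨by positivity, ?_⟩
        exact div_le_one_of_le₀ (by exact_mod_cast h) (by positivity)
      · rw [smul_smul, mul_div_cancel₀ _ ht', ← hx]
  · intro h
    exact csInf_le (OrderBot.bddBelow _) h

theorem measurable_relDist (hE : (0 : Eucl n) ∈ interior (E : Set (Eucl n))) :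
    Measurable (relDist E K) := by
  refine measurable_of_Iic fun t => ?_
  convert (K + (t : ℝ) • E).isClosed.measurableSet using 1
  ext x
  exact relDist_le_iff hE

/-- Convexity of `E` turns `(a d) E + (b d') E` into `(a d + b d') E`. -/
theorem relDist_combination_le (hE : (0 : Eucl n) ∈ interior (E : Set (Eucl n))) {a b : ℝ≥0}
    (H : ∀ k ∈ K, ∀ k' ∈ L, (a : ℝ) • k + (b : ℝ) • k' ∈ M) (x y : Eucl n) :
    relDist E M ((a : ℝ) • x + (b : ℝ) • y) ≤ a * relDist E K x + b * relDist E L y := by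
  rw [relDist_le_iff hE]
  obtain ⟨k, hk, e, he, hx⟩ := mem_add_smul_iff.1 ((relDist_le_iff (K := K) hE (x := x)).1 le_rfl)
  obtain ⟨k', hk', e', he', hy⟩ :=
    mem_add_smul_iff.1 ((relDist_le_iff (K := L) hE (x := y)).1 le_rfl)
  set d := relDist E K x
  set d' := relDist E L y
  have : (a * d : ℝ) • e + (b * d' : ℝ) • e' ∈ ((a * d + b * d' : ℝ)) • (E : Set (Eucl n)) := by
    rw [E.convex.add_smul (by positivity) (by positivity)]
    exact add_mem_add (smul_mem_smul_set he) (smul_mem_smul_set he')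
  obtain ⟨f, hf, hfe⟩ := this
  refine mem_add_smul_iff.2 ⟨_, H k hk k' hk', f, hf, ?_⟩
  push_cast
  have hfe' : (a * d + b * d' : ℝ) • f = (a * d : ℝ) • e + (b * d' : ℝ) • e' := hfe
  rw [hfe', hx, hy]
  module

theorem relDist_eq_zero (hE : (0 : Eucl n) ∈ interior (E : Set (Eucl n))) {x : Eucl n}
    (hx : x ∈ K) : relDist E K x = 0 := by
  rw [← nonpos_iff_eq_zero, relDist_le_iff hE]
  exact mem_add_smul_iff.2 ⟨x, hx, 0, interior_subset hE, by simp⟩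

end RelDist

/-! ### Sublevel sets and the generalized Wills functional -/

theorem exp_neg_eq_mul_stdExp {a : ℝ} {y : EReal} (h : (a : EReal) ≤ y) :
    EReal.exp (-y) = ENNReal.ofReal (Real.exp (-a)) *
      stdExp {s : ℝ≥0 | y ≤ ((a + s : ℝ) : EReal)} := by
  induction y with
  | bot => simp at h
  | top =>
    have : {s : ℝ≥0 | (⊤ : EReal) ≤ ((a + s : ℝ) : EReal)} = ∅ := by
      ext s
      simpa only [Set.mem_ofPred_eq, top_le_iff, Set.mem_empty_iff_false, iff_false] using
        EReal.coe_ne_top _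
    rw [this, measure_empty, mul_zero, EReal.neg_top, EReal.exp_bot]
  | coe r =>
    rw [EReal.coe_le_coe_iff] at h
    have : {s : ℝ≥0 | (r : EReal) ≤ ((a + s : ℝ) : EReal)} = Set.Ici (r - a).toNNReal := by
      ext s
      rw [Set.mem_ofPred_eq, EReal.coe_le_coe_iff, Set.mem_Ici, Real.toNNReal_le_iff_le_coe,
        sub_le_iff_le_add']
    rw [this, stdExp_Ici, Real.coe_toNNReal _ (by linarith), ← ENNReal.ofReal_mul (by positivity),
      ← Real.exp_add, ← EReal.coe_neg, EReal.exp_coe]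
    ring_nf

theorem lintegral_exp_neg_eq {α : Type*} [MeasurableSpace α] (μ : Measure α) [SFinite μ]
    {f : α → EReal} (hf : Measurable f) {a : ℝ} (ha : ∀ x, (a : EReal) ≤ f x) :
    ∫⁻ x, EReal.exp (-f x) ∂μ = ENNReal.ofReal (Real.exp (-a)) *
      ∫⁻ s : ℝ≥0, μ {x | f x ≤ ((a + s : ℝ) : EReal)} ∂stdExp := by
  have hm : MeasurableSet {p : α × ℝ≥0 | f p.1 ≤ ((a + p.2 : ℝ) : EReal)} :=
    measurableSet_le (by fun_prop) (by fun_prop)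
  have e1 := Measure.prod_apply (μ := μ) (ν := stdExp) hm
  have e2 := Measure.prod_apply_symm (μ := μ) (ν := stdExp) hm
  have e3 : ∀ x, EReal.exp (-f x) = ENNReal.ofReal (Real.exp (-a)) *
      stdExp (Prod.mk x ⁻¹' {p : α × ℝ≥0 | f p.1 ≤ ((a + p.2 : ℝ) : EReal)}) :=
    fun x => exp_neg_eq_mul_stdExp (ha x)
  simp_rw [e3]
  rw [lintegral_const_mul _ (measurable_measure_prodMk_left hm), ← e1, e2]
  rfl

/-- Sublevel sets of `u ∘ d_E(·, K)`. -/
def sublevel {n : ℕ} (u : ℝ≥0 → EReal) (K E : ConvexBody (Eucl n)) (s : ℝ≥0) : Set (Eucl n) :=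
  {x | u (relDist E K x) ≤ (((u 0).toReal + s : ℝ) : EReal)}

theorem lintegral_pow_le {f : ℝ≥0 → ℝ≥0∞} (hf : Measurable f) {n : ℕ} (hn : n ≠ 0) :
    ∫⁻ s, f s ∂stdExp ≤ (∫⁻ s, f s ^ n ∂stdExp) ^ (1 / (n : ℝ)) := by
  have := eLpNorm'_le_eLpNorm'_of_exponent_le (p := 1) (q := n) zero_lt_one
    (by exact_mod_cast Nat.one_le_iff_ne_zero.2 hn) stdExp hf.aestronglyMeasurable
  simpa [eLpNorm'] using this

section Sublevel

variable {n : ℕ} {u : ℝ≥0 → EReal} {E K L M : ConvexBody (Eucl n)}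

theorem IsWeight.coe_toReal (hu : IsWeight u) (h0 : u 0 ≠ ⊤) : ((u 0).toReal : EReal) = u 0 :=
  EReal.coe_toReal h0 (hu.ne_bot 0)

theorem measurableSet_sublevel (hu : IsWeight u) (hE : (0 : Eucl n) ∈ interior (E : Set (Eucl n)))
    (s : ℝ≥0) : MeasurableSet (sublevel u K E s) :=
  measurableSet_le (hu.monotone.measurable.comp (measurable_relDist hE)) measurable_const

theorem subset_sublevel (hu : IsWeight u) (h0 : u 0 ≠ ⊤)
    (hE : (0 : Eucl n) ∈ interior (E : Set (Eucl n))) {x : Eucl n} (hx : x ∈ K) (s : ℝ≥0) :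
    x ∈ sublevel u K E s := by
  rw [sublevel, Set.mem_ofPred_eq, relDist_eq_zero hE hx, EReal.coe_add, hu.coe_toReal h0]
  exact le_add_of_nonneg_right (EReal.coe_nonneg.2 s.2)

/-- Levels average along with points. Equal levels give the Brunn–Minkowski step; level 0 against
level `s` inside one body gives the growth bound on `volRadius`. -/
theorem combination_mem_sublevel (hu : IsWeight u)
    (hE : (0 : Eucl n) ∈ interior (E : Set (Eucl n))) {a b : ℝ≥0} (hab : a + b = 1)
    (H : ∀ k ∈ K, ∀ k' ∈ L, (a : ℝ) • k + (b : ℝ) • k' ∈ M) {s t : ℝ≥0} {x y : Eucl n}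
    (hx : x ∈ sublevel u K E s) (hy : y ∈ sublevel u L E t) :
    (a : ℝ) • x + (b : ℝ) • y ∈ sublevel u M E (a * s + b * t) := by
  rw [sublevel, Set.mem_ofPred_eq] at *
  have hab' : (a : ℝ) + b = 1 := by exact_mod_cast hab
  calc _ ≤ u (a * relDist E K x + b * relDist E L y) :=
        hu.monotone (relDist_combination_le hE H x y)
    _ ≤ _ := hu.convex _ _ a b hab
    _ ≤ ((a : ℝ) : EReal) * (((u 0).toReal + s : ℝ) : EReal) +
        ((b : ℝ) : EReal) * (((u 0).toReal + t : ℝ) : EReal) := by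
        gcongr
    _ = _ := by
        rw [← EReal.coe_mul, ← EReal.coe_mul, ← EReal.coe_add]
        congr 1
        push_cast
        linear_combination (u 0).toReal * hab'

/-- The `n`-th root of the volume of the sublevel sets of `u ∘ d_E(·, K)`. -/
noncomputable def volRadius (u : ℝ≥0 → EReal) (K E : ConvexBody (Eucl n)) (s : ℝ≥0) : ℝ≥0∞ :=
  volume (sublevel u K E s) ^ (1 / (n : ℝ))

theorem monotone_volRadius : Monotone (volRadius u K E) := by
  intro s t hst
  refine ENNReal.rpow_le_rpow (measure_mono ?_) (by positivity)
  intro x hx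
  rw [sublevel, Set.mem_ofPred_eq] at *
  refine hx.trans ?_
  rw [EReal.coe_le_coe_iff]
  have : (s : ℝ) ≤ t := hst
  linarith

theorem mul_volRadius_le (hn : n ≠ 0) (hu : IsWeight u) (h0 : u 0 ≠ ⊤)
    (hE : (0 : Eucl n) ∈ interior (E : Set (Eucl n))) (t s : ℝ≥0) (ht : t ≤ 1) :
    t * volRadius u K E s ≤ volRadius u K E (t * s) := by
  obtain ⟨k, hk⟩ := K.nonempty
  rw [← ENNReal.ofReal_coe_nnreal]
  refine ofReal_mul_volume_rpow_le hn t.2 (((1 - t : ℝ≥0) : ℝ) • k) fun x hx => ?_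
  have hab : (1 - t) + t = 1 := tsub_add_cancel_of_le ht
  have := combination_mem_sublevel (M := K) (s := 0) hu hE hab (fun k hk k' hk' =>
    K.convex hk hk' (by positivity) (by positivity) (by exact_mod_cast hab))
    (subset_sublevel hu h0 hE hk 0) hx
  simpa using this

theorem volRadius_combination_le (hn : n ≠ 0) (hu : IsWeight u) (h0 : u 0 ≠ ⊤)
    (hE : (0 : Eucl n) ∈ interior (E : Set (Eucl n))) {l : ℝ} (hl0 : 0 < l) (hl1 : l < 1)
    (s : ℝ≥0) :
    ENNReal.ofReal (1 - l) * volRadius u K E s + ENNReal.ofReal l * volRadius u L E s ≤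
      volRadius u ((1 - l) • K + l • L) E s := by
  obtain ⟨k, hk⟩ := K.nonempty
  obtain ⟨k', hk'⟩ := L.nonempty
  lift l to ℝ≥0 using hl0.le
  have hl1' : l ≤ 1 := by exact_mod_cast hl1.le
  have hab : (1 - l) + l = 1 := tsub_add_cancel_of_le hl1'
  have hc : (1 : ℝ) - l = ((1 - l : ℝ≥0) : ℝ) := by rw [NNReal.coe_sub hl1', NNReal.coe_one]
  refine brunnMinkowski hn hl0 hl1 (measurableSet_sublevel hu hE s) (measurableSet_sublevel hu hE s)
    (measurableSet_sublevel hu hE s) ⟨k, subset_sublevel hu h0 hE hk s⟩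
    ⟨k', subset_sublevel hu h0 hE hk' s⟩ fun x hx y hy => ?_
  rw [hc]
  have := combination_mem_sublevel (M := (((1 - l : ℝ≥0) : ℝ)) • K + (l : ℝ) • L) hu hE hab
    (fun k hk k' hk' => Set.add_mem_add (Set.smul_mem_smul_set hk) (Set.smul_mem_smul_set hk'))
    hx hy
  rwa [← add_mul, hab, one_mul] at this

theorem genWills_eq (hn : n ≠ 0) (hu : IsWeight u) (h0 : u 0 ≠ ⊤)
    (hE : (0 : Eucl n) ∈ interior (E : Set (Eucl n))) (K : ConvexBody (Eucl n)) :
    genWills u K E = ENNReal.ofReal (Real.exp (-(u 0).toReal)) *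
      ∫⁻ s, volRadius u K E s ^ n ∂stdExp := by
  rw [genWills, lintegral_exp_neg_eq volume (f := fun x => u (relDist E K x))
    (hu.monotone.measurable.comp (measurable_relDist hE)) (a := (u 0).toReal)]
  · congr 2 with s
    rw [volRadius, ← ENNReal.rpow_natCast, ← ENNReal.rpow_mul,
      one_div_mul_cancel (by exact_mod_cast hn), ENNReal.rpow_one]
    rfl
  · intro x
    rw [hu.coe_toReal h0]
    exact hu.monotone bot_le

/-- The Brunn–Minkowski type inequality for the generalized Wills functional. -/
theorem genWills_brunnMinkowski (hn : n ≠ 0) (hu : IsWeight u)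
    (hE : (0 : Eucl n) ∈ interior (E : Set (Eucl n))) {l : ℝ} (hl0 : 0 < l) (hl1 : l < 1)
    (K L : ConvexBody (Eucl n)) :
    ENNReal.ofReal (1 - l) * genWills u K E ^ (1 / (n : ℝ)) +
        ENNReal.ofReal l * genWills u L E ^ (1 / (n : ℝ)) ≤
      (n ! : ℝ≥0∞) ^ (1 / (n : ℝ)) * genWills u ((1 - l) • K + l • L) E ^ (1 / (n : ℝ)) := by
  have hn' : (0 : ℝ) < 1 / n := by positivity
  -- Here `u` is identically `∞` and every functional vanishes.
  by_cases h0 : u 0 = ⊤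
  · have hz : ∀ K : ConvexBody (Eucl n), genWills u K E = 0 := fun K => by
      have : ∀ t, u t = ⊤ := fun t => top_le_iff.1 (h0 ▸ hu.monotone (bot_le : 0 ≤ t))
      simp [genWills, this]
    simp only [hz, ENNReal.zero_rpow_of_pos hn', mul_zero, add_zero, le_refl]
  simp only [genWills_eq hn hu h0 hE, ENNReal.mul_rpow_of_nonneg _ _ hn'.le]
  set c := ENNReal.ofReal (Real.exp (-(u 0).toReal)) ^ (1 / (n : ℝ))
  set N := (n ! : ℝ≥0∞) ^ (1 / (n : ℝ))
  have hB : ∀ K : ConvexBody (Eucl n), (∫⁻ s, volRadius u K E s ^ n ∂stdExp) ^ (1 / (n : ℝ)) ≤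
      N * ∫⁻ s, volRadius u K E s ∂stdExp := fun K => by
    have := ENNReal.rpow_le_rpow (lintegral_pow_le_factorial_mul (monotone_volRadius (K := K))
      (mul_volRadius_le hn hu h0 hE) n hn) hn'.le
    rwa [ENNReal.mul_rpow_of_nonneg _ _ hn'.le, ← ENNReal.rpow_natCast (∫⁻ s, _ ∂_),
      ← ENNReal.rpow_mul, mul_one_div_cancel (by exact_mod_cast hn), ENNReal.rpow_one] at this
  calc _ ≤ ENNReal.ofReal (1 - l) * (c * (N * ∫⁻ s, volRadius u K E s ∂stdExp)) +
        ENNReal.ofReal l * (c * (N * ∫⁻ s, volRadius u L E s ∂stdExp)) := by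
        gcongr <;> exact hB _
    _ = N * (c * (ENNReal.ofReal (1 - l) * (∫⁻ s, volRadius u K E s ∂stdExp) +
        ENNReal.ofReal l * ∫⁻ s, volRadius u L E s ∂stdExp)) := by ring
    _ = N * (c * ∫⁻ s, (ENNReal.ofReal (1 - l) * volRadius u K E s +
        ENNReal.ofReal l * volRadius u L E s) ∂stdExp) := by
        rw [lintegral_add_left (monotone_volRadius.measurable.const_mul _),
          lintegral_const_mul _ monotone_volRadius.measurable,
          lintegral_const_mul _ monotone_volRadius.measurable]
    _ ≤ N * (c * ∫⁻ s, volRadius u ((1 - l) • K + l • L) E s ∂stdExp) := by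
        gcongr with s
        exact volRadius_combination_le hn hu h0 hE hl0 hl1 s
    _ ≤ _ := by
        gcongr
        exact lintegral_pow_le monotone_volRadius.measurable hn

end Sublevel

end Wills

/-! ### Nearest points and polyhedra -/

namespace Wills

open scoped InnerProductSpace

section Projection

variable {E : Type*} [NormedAddCommGroup E] [InnerProductSpace ℝ E]

/-- `p` is the nearest-point projection onto the convex set `K`. -/
structure IsNearestPoint (K : Set E) (p : E → E) : Prop where
  mem : ∀ x, p x ∈ K
  inner_le : ∀ x, ∀ w ∈ K, ⟪x - p x, w - p x⟫_ℝ ≤ 0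

theorem exists_isNearestPoint [CompleteSpace E] {K : Set E} (hK : Convex ℝ K) (hc : IsClosed K)
    (hne : K.Nonempty) : ∃ p, IsNearestPoint K p := by
  choose p hp hp' using exists_norm_eq_iInf_of_complete_convex hne hc.isComplete hK
  exact ⟨p, hp, fun x => (norm_eq_iInf_iff_real_inner_le_zero hK (hp x)).1 (hp' x)⟩

/-- The set of points at distance at most `t` from some point of `K`. -/
def tube (K : Set E) (t : ℝ) : Set E := {x | ∃ k ∈ K, ‖x - k‖ ≤ t}

theorem isBounded_tube {F : Type*} [NormedAddCommGroup F] {K : Set F}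
    (hb : Bornology.IsBounded K) (t : ℝ) :
    Bornology.IsBounded (tube K t) := by
  obtain ⟨R, hR⟩ := hb.exists_norm_le
  refine (Metric.isBounded_closedBall (x := (0 : F)) (r := R + t)).subset fun x hx => ?_
  rw [mem_closedBall_zero_iff]
  obtain ⟨k, hk, h⟩ := hx
  calc ‖x‖ = ‖k + (x - k)‖ := by rw [add_sub_cancel]
    _ ≤ ‖k‖ + ‖x - k‖ := norm_add_le _ _
    _ ≤ _ := add_le_add (hR k hk) h

namespace IsNearestPoint

variable {K : Set E} {p : E → E}

theorem eq_of_inner_le (hp : IsNearestPoint K p) {x y : E} (hy : y ∈ K)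
    (h : ∀ w ∈ K, ⟪x - y, w - y⟫_ℝ ≤ 0) : p x = y := by
  have h1 := hp.inner_le x y hy
  have h2 := h _ (hp.mem x)
  have h3 : ⟪p x - y, p x - y⟫_ℝ = ⟪x - p x, y - p x⟫_ℝ + ⟪x - y, p x - y⟫_ℝ := by
    have e : y - p x = -(p x - y) := by abel
    rw [e, inner_neg_right, neg_add_eq_sub, ← inner_sub_left]
    congr 1
    abel
  rw [← sub_eq_zero, ← inner_self_eq_zero (𝕜 := ℝ)]
  exact le_antisymm (by linarith) real_inner_self_nonneg

theorem dist_le (hp : IsNearestPoint K p) (x y : E) : ‖p x - p y‖ ≤ ‖x - y‖ := by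
  have h1 := hp.inner_le x _ (hp.mem y)
  have h2 := hp.inner_le y _ (hp.mem x)
  have h3 : ⟪p x - p y, p x - p y⟫_ℝ ≤ ⟪x - y, p x - p y⟫_ℝ := by
    have : ⟪x - y, p x - p y⟫_ℝ - ⟪p x - p y, p x - p y⟫_ℝ =
        -⟪x - p x, p y - p x⟫_ℝ - ⟪y - p y, p x - p y⟫_ℝ := by
      have e : p y - p x = -(p x - p y) := by abel
      rw [e, inner_neg_right, neg_neg, ← inner_sub_left, ← inner_sub_left]
      congr 1
      abel
    linarith
  have h4 := real_inner_le_norm (x - y) (p x - p y)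
  rw [real_inner_self_eq_norm_sq] at h3
  rcases (norm_nonneg (p x - p y)).eq_or_lt with h | h
  · rw [← h]; positivity
  · nlinarith

theorem continuous (hp : IsNearestPoint K p) : Continuous p := by
  refine LipschitzWith.continuous (K := 1) (LipschitzWith.of_dist_le_mul fun x y => ?_)
  simpa [dist_eq_norm] using hp.dist_le x y

theorem mem_tube_iff (hp : IsNearestPoint K p) {x : E} {t : ℝ} :
    x ∈ tube K t ↔ ‖x - p x‖ ≤ t := by
  refine ⟨?_, fun h => ⟨_, hp.mem x, h⟩⟩
  rintro ⟨k, hk, h⟩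
  refine le_trans ?_ h
  have h1 := hp.inner_le x k hk
  have h2 : ‖x - k‖ ^ 2 = ‖x - p x‖ ^ 2 - 2 * ⟪x - p x, k - p x⟫_ℝ + ‖k - p x‖ ^ 2 := by
    rw [← norm_sub_sq_real]
    congr 2
    abel
  nlinarith [norm_nonneg (x - k), norm_nonneg (x - p x), sq_nonneg ‖k - p x‖]

theorem isClosed_tube (hp : IsNearestPoint K p) (t : ℝ) : IsClosed (tube K t) := by
  have hc := hp.continuous
  have : tube K t = {x | ‖x - p x‖ ≤ t} := Set.ext fun x => hp.mem_tube_iff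
  rw [this]
  exact isClosed_le (by fun_prop) (by fun_prop)

/-- The variational inequality characterising `p x` is positively homogeneous in `x - p x`. -/
theorem apply_ray (hp : IsNearestPoint K p) (x : E) {t : ℝ} (ht : 0 ≤ t) :
    p (p x + t • (x - p x)) = p x := by
  refine hp.eq_of_inner_le (hp.mem x) fun w hw => ?_
  rw [add_sub_cancel_left, inner_smul_left]
  exact mul_nonpos_of_nonneg_of_nonpos ht (hp.inner_le x w hw)

end IsNearestPoint

/-- The polyhedron cut out by the inequalities `⟪a, x⟫ ≤ b` for `(a, b) ∈ S`. -/
def polyhedron (S : Finset (E × ℝ)) : Set E := {x | ∀ q ∈ S, ⟪q.1, x⟫_ℝ ≤ q.2}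

theorem convex_polyhedron (S : Finset (E × ℝ)) : Convex ℝ (polyhedron S) := by
  intro x hx y hy a b ha hb hab q hq
  have h1 := hx q hq
  have h2 := hy q hq
  rw [inner_add_right, inner_smul_right, inner_smul_right]
  calc _ ≤ a * q.2 + b * q.2 := by gcongr
    _ = q.2 := by rw [← add_mul, hab, one_mul]

theorem isClosed_polyhedron (S : Finset (E × ℝ)) : IsClosed (polyhedron S) := by
  have : polyhedron S = ⋂ q ∈ S, {x | ⟪q.1, x⟫_ℝ ≤ q.2} := by
    ext x
    simp [polyhedron]
  rw [this]
  exact isClosed_biInter fun q _ => isClosed_le (by fun_prop) (by fun_prop)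

/-- The linear subspace of directions annihilated by the constraints in `J`. -/
def lineality (J : Finset (E × ℝ)) : Submodule ℝ E where
  carrier := {v | ∀ q ∈ J, ⟪q.1, v⟫_ℝ = 0}
  add_mem' := fun hx hy q hq => by rw [inner_add_right, hx q hq, hy q hq, add_zero]
  zero_mem' := fun q _ => inner_zero_right _
  smul_mem' := fun c x hx q hq => by rw [inner_smul_right, hx q hq, mul_zero]

open Classical in
/-- The constraints in `S` that are active at `y`. -/
noncomputable def active (S : Finset (E × ℝ)) (y : E) : Finset (E × ℝ) :=
  S.filter fun q => ⟪q.1, y⟫_ℝ = q.2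

theorem sub_mem_lineality {S : Finset (E × ℝ)} {y z : E} (h : active S y = active S z) :
    y - z ∈ lineality (active S z) := by
  intro q hq
  have h1 : q ∈ active S y := h ▸ hq
  rw [active, Finset.mem_filter] at h1 hq
  rw [inner_sub_right, h1.2, hq.2, sub_self]

/-- Moving from `p x` by a small multiple of `±v`, with `v` in the lineality space, keeps active
constraints tight and uses only slack in the others. The point stays in the polyhedron, so the
variational inequality holds with both signs. -/
theorem IsNearestPoint.sub_mem_lineality_orthogonal {S : Finset (E × ℝ)} {p : E → E}
    (hp : IsNearestPoint (polyhedron S) p) (x : E) :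
    x - p x ∈ (lineality (active S (p x)))ᗮ := by
  have key : ∀ v ∈ lineality (active S (p x)), ⟪x - p x, v⟫_ℝ ≤ 0 := by
    intro v hv
    have : ∀ᶠ ε : ℝ in nhdsWithin 0 (Set.Ioi 0), ∀ q ∈ S, ⟪q.1, p x + ε • v⟫_ℝ ≤ q.2 := by
      rw [Filter.eventually_all_finset]
      intro q hq
      by_cases hqa : ⟪q.1, p x⟫_ℝ = q.2
      · refine Filter.Eventually.of_forall fun ε => ?_
        have := hv q (by rw [active, Finset.mem_filter]; exact ⟨hq, hqa⟩)
        rw [inner_add_right, inner_smul_right, this, mul_zero, add_zero, hqa]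
      · have hlt : ⟪q.1, p x⟫_ℝ < q.2 := lt_of_le_of_ne (hp.mem x q hq) hqa
        have hc : ContinuousAt (fun ε : ℝ => ⟪q.1, p x + ε • v⟫_ℝ) 0 := by fun_prop
        have h0 : Filter.Tendsto (fun ε : ℝ => ⟪q.1, p x + ε • v⟫_ℝ) (nhdsWithin 0 (Set.Ioi 0))
            (nhds ⟪q.1, p x⟫_ℝ) := by
          simpa [ContinuousAt] using hc.tendsto.mono_left nhdsWithin_le_nhds
        filter_upwards [h0.eventually_lt_const hlt] with ε h
        exact h.le
    obtain ⟨ε, hε, hε0⟩ := (this.and self_mem_nhdsWithin).exists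
    have h := hp.inner_le x _ hε
    rw [add_sub_cancel_left, inner_smul_right] at h
    have hε0' : (0 : ℝ) < ε := hε0
    by_contra! h'
    have := mul_pos hε0' h'
    linarith
  rw [Submodule.mem_orthogonal']
  intro v hv
  have h1 := key v hv
  have h2 := key (-v) (neg_mem hv)
  rw [inner_neg_right] at h2
  linarith

/-- The points of the tube whose nearest point has `J` as its set of active constraints. -/
def tubePiece (S : Finset (E × ℝ)) (p : E → E) (J : Finset (E × ℝ)) (t : ℝ) : Set E :=
  {x | active S (p x) = J ∧ ‖x - p x‖ ≤ t}

theorem measurableSet_tubePiece [MeasurableSpace E] [BorelSpace E] {S : Finset (E × ℝ)}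
    {p : E → E} (hp : IsNearestPoint (polyhedron S) p) (J : Finset (E × ℝ))
    (t : ℝ) : MeasurableSet (tubePiece S p J t) := by
  have hc := hp.continuous
  have : ∀ x, active S (p x) = J ↔ J ⊆ S ∧ ∀ q ∈ S, (⟪q.1, p x⟫_ℝ = q.2 ↔ q ∈ J) := by
    intro x
    constructor
    · rintro rfl
      refine ⟨Finset.filter_subset _ _, fun q hq => ?_⟩
      rw [active, Finset.mem_filter, and_iff_right hq]
    · rintro ⟨h1, h2⟩
      ext q
      rw [active, Finset.mem_filter]
      exact ⟨fun h => (h2 q h.1).1 h.2, fun h => ⟨h1 h, (h2 q (h1 h)).2 h⟩⟩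
  have e : tubePiece S p J t = ({_x | J ⊆ S} ∩ ⋂ q ∈ S, {x | ⟪q.1, p x⟫_ℝ = q.2 ↔ q ∈ J}) ∩
      {x | ‖x - p x‖ ≤ t} := by
    ext x
    rw [tubePiece, Set.mem_ofPred_eq, this]
    simp
  have hcl : IsClosed {x | ‖x - p x‖ ≤ t} := isClosed_le (by fun_prop) (by fun_prop)
  rw [e]
  refine ((MeasurableSet.const _).inter (S.measurableSet_biInter fun q _ => ?_)).inter
    hcl.measurableSet
  have hcl : MeasurableSet {x | ⟪q.1, p x⟫_ℝ = q.2} :=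
    (isClosed_eq (by fun_prop) (by fun_prop)).measurableSet
  by_cases hq : q ∈ J
  · simpa [hq] using hcl
  · convert hcl.compl using 1
    ext x
    simp [hq]

end Projection

/-! ### Tube volumes of polyhedra -/

section Polynomial

variable {E : Type*} [NormedAddCommGroup E] [InnerProductSpace ℝ E] [FiniteDimensional ℝ E]

/-- The linear map that is the identity on `V` and multiplication by `t` on `Vᗮ`. -/
noncomputable def stretch (V : Submodule ℝ E) (t : ℝ) : E →ₗ[ℝ] E :=
  t • LinearMap.id + (1 - t) • (V.starProjection : E →ₗ[ℝ] E)

theorem stretch_apply (V : Submodule ℝ E) (t : ℝ) {v w : E} (hv : v ∈ V) (hw : w ∈ Vᗮ) :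
    stretch V t (v + w) = v + t • w := by
  have h1 : V.starProjection v = v := Submodule.starProjection_eq_self_iff.2 hv
  have h2 : V.starProjection w = 0 := (Submodule.starProjection_apply_eq_zero_iff V).2 hw
  simp only [stretch, LinearMap.add_apply, LinearMap.smul_apply, LinearMap.id_apply,
    ContinuousLinearMap.coe_coe, map_add, h1, h2]
  module

/-- The map is block triangular along `Vᗮ`: multiplication by `t` there, the identity on the
quotient. -/
theorem det_stretch (V : Submodule ℝ E) (t : ℝ) :
    LinearMap.det (stretch V t) = t ^ Module.finrank ℝ Vᗮ := by
  have hle : ∀ w ∈ Vᗮ, stretch V t w ∈ Vᗮ := by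
    intro w hw
    have := stretch_apply V t (zero_mem V) hw
    rw [zero_add, zero_add] at this
    rw [this]
    exact Submodule.smul_mem _ _ hw
  have h1 : (stretch V t).restrict hle = t • LinearMap.id := by
    ext ⟨w, hw⟩
    have := stretch_apply V t (zero_mem V) hw
    rw [zero_add, zero_add] at this
    simpa using this
  have h2 : Vᗮ.mapQ Vᗮ (stretch V t) hle = LinearMap.id := by
    ext x
    simp only [LinearMap.comp_apply, Submodule.mkQ_apply, Submodule.mapQ_apply,
      LinearMap.id_apply]
    rw [Submodule.Quotient.eq]
    obtain ⟨v, hv, w, hw, rfl⟩ := V.exists_add_mem_mem_orthogonal x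
    rw [stretch_apply V t hv hw, add_sub_add_left_eq_sub]
    exact Submodule.sub_mem _ (Submodule.smul_mem _ _ hw) hw
  calc LinearMap.det (stretch V t) =
        LinearMap.det ((stretch V t).restrict hle) *
          LinearMap.det (Vᗮ.mapQ Vᗮ (stretch V t) hle) := LinearMap.det_eq_det_mul_det Vᗮ _ hle
    _ = _ := by rw [h1, h2, LinearMap.det_smul, LinearMap.det_id, LinearMap.det_id, mul_one, mul_one]

variable {S : Finset (E × ℝ)} {p : E → E}

/-- On one piece, `x - p x₀` splits into `p x - p x₀` in the lineality space and the normal part `x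
- p x`. Scaling the normal part by `t` leaves the nearest point unchanged. -/
theorem tubePiece_eq_image (hp : IsNearestPoint (polyhedron S) p) {J : Finset (E × ℝ)} {x₀ : E}
    (hx₀ : active S (p x₀) = J) {t : ℝ} (ht : 0 ≤ t) :
    tubePiece S p J t =
      (fun x => p x₀ + x) '' (stretch (lineality J) t '' ((fun x => x + p x₀) ⁻¹' tubePiece S p J 1)) := by
  have key : ∀ x, active S (p x) = J →
      stretch (lineality J) t (x - p x₀) = p x - p x₀ + t • (x - p x) := by
    intro x hx
    have h1 : p x - p x₀ ∈ lineality J := hx₀ ▸ sub_mem_lineality (hx.trans hx₀.symm)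
    have h2 : x - p x ∈ (lineality J)ᗮ := hx ▸ hp.sub_mem_lineality_orthogonal x
    rw [← stretch_apply _ t h1 h2]
    congr 1
    abel
  ext y
  constructor
  · rintro ⟨hy, hyt⟩
    have hpz := hp.apply_ray y (inv_nonneg.2 ht)
    -- For `t = 0` the convention `t⁻¹ = 0` gives `z = p y`, which equals `y`.
    set z := p y + t⁻¹ • (y - p y) with hz
    have hzJ : active S (p z) = J := by rw [hpz, hy]
    have hzy : z - p y = t⁻¹ • (y - p y) := by rw [hz, add_sub_cancel_left]
    refine ⟨_, ⟨z - p x₀, ?_, rfl⟩, ?_⟩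
    · simp only [Set.mem_preimage, sub_add_cancel]
      refine ⟨hzJ, ?_⟩
      rw [hpz, hzy, norm_smul, norm_inv, Real.norm_of_nonneg ht]
      exact inv_mul_le_one_of_le₀ hyt ht
    · simp only
      rw [key z hzJ, hpz, hzy]
      rcases eq_or_ne t 0 with rfl | ht0
      · rw [norm_le_zero_iff, sub_eq_zero] at hyt
        rw [zero_smul, add_zero, add_sub_cancel]
        exact hyt.symm
      · rw [smul_smul, mul_inv_cancel₀ ht0, one_smul]
        abel
  · rintro ⟨_, ⟨x, ⟨hx, hx1⟩, rfl⟩, rfl⟩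
    simp only
    have h := key _ hx
    rw [add_sub_cancel_right] at h
    have e : p x₀ + stretch (lineality J) t x =
        p (x + p x₀) + t • (x + p x₀ - p (x + p x₀)) := by rw [h]; abel
    rw [e]
    refine ⟨by rw [hp.apply_ray _ ht, hx], ?_⟩
    rw [hp.apply_ray _ ht, add_sub_cancel_left, norm_smul, Real.norm_of_nonneg ht]
    exact mul_le_of_le_one_right ht hx1

variable [MeasurableSpace E] [BorelSpace E]

theorem volume_tubePiece (hp : IsNearestPoint (polyhedron S) p) (J : Finset (E × ℝ)) {t : ℝ}
    (ht : 0 ≤ t) :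
    volume (tubePiece S p J t) =
      ENNReal.ofReal (t ^ Module.finrank ℝ (lineality J)ᗮ) * volume (tubePiece S p J 1) := by
  by_cases h : ∃ x₀, active S (p x₀) = J
  · obtain ⟨x₀, hx₀⟩ := h
    rw [tubePiece_eq_image hp hx₀ ht, Set.image_add_left, measure_preimage_add,
      Measure.addHaar_image_linearMap, det_stretch, measure_preimage_add_right,
      abs_of_nonneg (by positivity)]
  · have : ∀ t, tubePiece S p J t = ∅ := fun t =>
      Set.eq_empty_of_forall_notMem fun x hx => h ⟨x, hx.1⟩
    simp [this]

-- The pieces partition the tube, and each contributes a monomial whose degree is the codimension of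
-- its lineality space.
open Classical in
theorem exists_polynomial_volume_tube_polyhedron (hne : (polyhedron S).Nonempty)
    (hb : Bornology.IsBounded (polyhedron S)) :
    ∃ P : Polynomial ℝ, P.natDegree ≤ Module.finrank ℝ E ∧
      ∀ t, 0 ≤ t → volume.real (tube (polyhedron S) t) = P.eval t := by
  obtain ⟨p, hp⟩ := exists_isNearestPoint (convex_polyhedron S) (isClosed_polyhedron S) hne
  have hfin : ∀ t, volume (tube (polyhedron S) t) ≠ ∞ := fun t =>
    (isBounded_tube hb t).measure_lt_top.ne
  have hsub : ∀ J t, tubePiece S p J t ⊆ tube (polyhedron S) t := fun J t x hx =>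
    hp.mem_tube_iff.2 hx.2
  have hunion : ∀ t, tube (polyhedron S) t = ⋃ J ∈ S.powerset, tubePiece S p J t := by
    intro t
    refine Set.Subset.antisymm (fun x hx => ?_) (Set.iUnion₂_subset fun J _ => hsub J t)
    rw [Set.mem_iUnion₂]
    exact ⟨active S (p x), Finset.mem_powerset.2 (Finset.filter_subset _ _), rfl,
      hp.mem_tube_iff.1 hx⟩
  refine ⟨∑ J ∈ S.powerset, Polynomial.C (volume.real (tubePiece S p J 1)) *
    Polynomial.X ^ Module.finrank ℝ (lineality J)ᗮ, ?_, fun t ht => ?_⟩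
  · refine Polynomial.natDegree_sum_le_of_forall_le _ _ fun J _ => ?_
    exact (Polynomial.natDegree_C_mul_X_pow_le _ _).trans (Submodule.finrank_le _)
  · rw [hunion, measureReal_def, measure_biUnion_finset]
    · rw [ENNReal.toReal_sum fun J _ => ne_top_of_le_ne_top (hfin t) (measure_mono (hsub J t)),
        Polynomial.eval_finsetSum]
      refine Finset.sum_congr rfl fun J _ => ?_
      rw [volume_tubePiece hp J ht, ENNReal.toReal_mul, ENNReal.toReal_ofReal (by positivity)]
      simp only [Polynomial.eval_mul, Polynomial.eval_C, Polynomial.eval_pow, Polynomial.eval_X,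
        measureReal_def]
      ring
    · intro I _ J _ hIJ
      refine Set.disjoint_left.2 fun x hx hx' => hIJ (hx.1.symm.trans hx'.1)
    · exact fun J _ => measurableSet_tubePiece hp J t

end Polynomial
end Wills

/-! ### The Steiner formula for convex bodies -/

namespace Wills

open scoped InnerProductSpace

section Steiner

open Filter Topology

/-- Degree at most `n` means that the values at `0, …, n` determine the polynomial through
Lagrange's formula, which is continuous in those values. -/
theorem exists_polynomial_of_tendsto_eval {n : ℕ} {P : ℕ → Polynomial ℝ}
    (hP : ∀ m, (P m).natDegree ≤ n) {f : ℝ → ℝ}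
    (hf : ∀ t, 0 ≤ t → Tendsto (fun m => (P m).eval t) atTop (𝓝 (f t))) :
    ∃ Q : Polynomial ℝ, Q.natDegree ≤ n ∧ ∀ t, 0 ≤ t → f t = Q.eval t := by
  have hinj : Set.InjOn (fun i : ℕ => (i : ℝ)) (Finset.range (n + 1)) :=
    Nat.cast_injective.injOn
  refine ⟨Lagrange.interpolate (Finset.range (n + 1)) (fun i : ℕ => (i : ℝ)) fun i => f i,
    ?_, fun t ht => ?_⟩
  · refine Polynomial.natDegree_le_of_degree_le ?_
    simpa using Lagrange.degree_interpolate_le (r := fun i : ℕ => f i) hinj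
  · refine tendsto_nhds_unique (hf t ht) ?_
    have e : ∀ m, P m = Lagrange.interpolate (Finset.range (n + 1)) (fun i : ℕ => (i : ℝ))
        fun i => (P m).eval (i : ℝ) := fun m => by
      refine Lagrange.eq_interpolate hinj ?_
      rw [Finset.card_range]
      exact lt_of_le_of_lt Polynomial.degree_le_natDegree
        (by exact_mod_cast Nat.lt_succ_of_le (hP m))
    rw [show (fun m => (P m).eval t) = _ from funext fun m => congrArg (Polynomial.eval t) (e m)]
    simp only [Lagrange.interpolate_apply, Polynomial.eval_finsetSum, Polynomial.eval_mul,
      Polynomial.eval_C]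
    exact tendsto_finsetSum _ fun i _ => (hf i (Nat.cast_nonneg i)).mul_const _

variable {n : ℕ}

theorem coe_add_smul_unitBall (K : ConvexBody (Eucl n)) {t : ℝ} (ht : 0 ≤ t) :
    ((K + t • unitBall n : ConvexBody (Eucl n)) : Set (Eucl n)) = tube (K : Set (Eucl n)) t := by
  ext x
  rw [SetLike.mem_coe, mem_add_smul_iff]
  have hB : ∀ e, e ∈ unitBall n ↔ ‖e‖ ≤ 1 := fun e => mem_closedBall_zero_iff
  constructor
  · rintro ⟨k, hk, e, he, rfl⟩
    refine ⟨k, hk, ?_⟩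
    rw [add_sub_cancel_left, norm_smul, Real.norm_of_nonneg ht]
    exact mul_le_of_le_one_right ht ((hB e).1 he)
  · rintro ⟨k, hk, h⟩
    refine ⟨k, hk, t⁻¹ • (x - k), (hB _).2 ?_, ?_⟩
    · rw [norm_smul, norm_inv, Real.norm_of_nonneg ht]
      exact inv_mul_le_one_of_le₀ h ht
    · rcases eq_or_ne t 0 with rfl | ht0
      · rw [norm_le_zero_iff, sub_eq_zero] at h
        simp [h]
      · rw [smul_smul, mul_inv_cancel₀ ht0, one_smul, add_sub_cancel]

open Classical in
/-- A convex body is the intersection of a decreasing sequence of bounded polyhedra. -/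
theorem exists_polyhedron_seq (K : ConvexBody (Eucl n)) :
    ∃ S : ℕ → Finset (Eucl n × ℝ), Monotone S ∧
      (∀ m, Bornology.IsBounded (polyhedron (S m))) ∧
      (K : Set (Eucl n)) = ⋂ m, polyhedron (S m) := by
  obtain ⟨p, hp⟩ := exists_isNearestPoint K.convex K.isClosed K.nonempty
  obtain ⟨R, hR⟩ := K.isBounded.exists_norm_le
  let e : Fin n → Eucl n := fun i => EuclideanSpace.single i 1
  -- A box containing `K`, included to make every polyhedron bounded.
  let S₀ : Finset (Eucl n × ℝ) :=
    Finset.univ.image (fun i => (e i, R)) ∪ Finset.univ.image (fun i => (-e i, R))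
  -- The half-space supporting `K` at `p q` with outer normal `q - p q`.
  let h : Eucl n → Eucl n × ℝ := fun q => (q - p q, ⟪q - p q, p q⟫_ℝ)
  have hS₀ : ∀ x, x ∈ polyhedron S₀ ↔ ∀ i, |x i| ≤ R := by
    intro x
    simp only [polyhedron, S₀, e, Finset.mem_union, Finset.mem_image, Finset.mem_univ, true_and,
      Set.mem_ofPred_eq, abs_le]
    constructor
    · intro H i
      have h1 := H _ (Or.inl ⟨i, rfl⟩)
      have h2 := H _ (Or.inr ⟨i, rfl⟩)
      simp [EuclideanSpace.inner_single_left, inner_neg_left] at h1 h2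
      exact ⟨by linarith, h1⟩
    · rintro H q (⟨i, rfl⟩ | ⟨i, rfl⟩)
      · simpa [EuclideanSpace.inner_single_left] using (H i).2
      · simp [EuclideanSpace.inner_single_left, inner_neg_left]
        linarith [(H i).1]
  have hbdd : Bornology.IsBounded (polyhedron S₀) := by
    refine (Metric.isBounded_closedBall (x := (0 : Eucl n)) (r := √(n * R ^ 2))).subset
      fun x hx => ?_
    rw [mem_closedBall_zero_iff, EuclideanSpace.norm_eq]
    refine Real.sqrt_le_sqrt ?_
    calc ∑ i, ‖x i‖ ^ 2 ≤ ∑ _i : Fin n, R ^ 2 := by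
          gcongr with i
          exact (hS₀ x).1 hx i
      _ = _ := by simp
  have hanti : ∀ {S T : Finset (Eucl n × ℝ)}, S ⊆ T → polyhedron T ⊆ polyhedron S :=
    fun hST x hx q hq => hx q (hST hq)
  refine ⟨fun m => S₀ ∪ (Finset.range m).image fun j => h (TopologicalSpace.denseSeq (Eucl n) j),
    ?_, fun m => hbdd.subset (hanti Finset.subset_union_left), ?_⟩
  · intro m m' hm
    exact Finset.union_subset_union_right (Finset.image_subset_image (Finset.range_mono hm))
  · ext x
    rw [Set.mem_iInter]
    constructor
    · intro hx m q hq
      rw [Finset.mem_union, Finset.mem_image] at hq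
      rcases hq with hq | ⟨j, _, rfl⟩
      · refine (hS₀ x).2 (fun i => ?_) q hq
        exact (PiLp.norm_apply_le x i).trans (hR x hx)
      · have := hp.inner_le (TopologicalSpace.denseSeq (Eucl n) j) x hx
        rw [inner_sub_right] at this
        simp only [h]
        linarith
    · intro hx
      have hc := hp.continuous
      -- The inequality holds for a dense set of `q`, hence by continuity for `q = x`, where it
      -- reads `‖x - p x‖² ≤ 0`.
      have hcl : IsClosed {q : Eucl n | ⟪q - p q, x - p q⟫_ℝ ≤ 0} :=
        isClosed_le (by fun_prop) (by fun_prop)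
      have hsub : Set.range (TopologicalSpace.denseSeq (Eucl n)) ⊆
          {q : Eucl n | ⟪q - p q, x - p q⟫_ℝ ≤ 0} := by
        rintro _ ⟨j, rfl⟩
        have := hx (j + 1) (h (TopologicalSpace.denseSeq (Eucl n) j))
          (Finset.mem_union_right _ (Finset.mem_image_of_mem _ (Finset.self_mem_range_succ j)))
        simp only [h] at this
        rw [Set.mem_ofPred_eq, inner_sub_right]
        linarith
      have hx' := hcl.closure_subset_iff.2 hsub
        ((TopologicalSpace.denseRange_denseSeq (Eucl n)) x)
      rw [Set.mem_ofPred_eq] at hx'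
      have h0 := inner_self_eq_zero.1 (le_antisymm hx' real_inner_self_nonneg)
      rw [sub_eq_zero.1 h0]
      exact hp.mem x

/-- The sets `P m ∩ closedBall x t` are nested, compact and non-empty, so one centre serves all `m`.
-/
theorem tube_iInter {E : Type*} [NormedAddCommGroup E] [ProperSpace E] {P : ℕ → Set E}
    (hP : Antitone P) (hc : ∀ m, IsClosed (P m)) (t : ℝ) :
    tube (⋂ m, P m) t = ⋂ m, tube (P m) t := by
  ext x
  rw [Set.mem_iInter]
  constructor
  · rintro ⟨k, hk, h⟩ m
    exact ⟨k, Set.mem_iInter.1 hk m, h⟩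
  · intro hx
    obtain ⟨k, hk⟩ := IsCompact.nonempty_iInter_of_sequence_nonempty_isCompact_isClosed
      (fun m => P m ∩ Metric.closedBall x t)
      (fun m => Set.inter_subset_inter_left _ (hP (Nat.le_succ m)))
      (fun m => by
        obtain ⟨k, hk, h⟩ := hx m
        exact ⟨k, hk, by rwa [mem_closedBall_iff_norm']⟩)
      ((isCompact_closedBall x t).inter_left (hc 0))
      (fun m => (hc m).inter Metric.isClosed_closedBall)
    rw [Set.mem_iInter] at hk
    exact ⟨k, Set.mem_iInter.2 fun m => (hk m).1, 
      mem_closedBall_iff_norm'.1 (hk 0).2⟩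

/-- The Steiner formula for the Euclidean unit ball. -/
theorem exists_isSteinerPolynomial (K : ConvexBody (Eucl n)) :
    ∃ P, IsSteinerPolynomial K (unitBall n) P := by
  obtain ⟨S, hS, hb, hK⟩ := exists_polyhedron_seq K
  have hne : ∀ m, (polyhedron (S m)).Nonempty := fun m =>
    K.nonempty.mono (hK ▸ Set.iInter_subset _ m)
  choose P hPd hPe using fun m => exists_polynomial_volume_tube_polyhedron (hne m) (hb m)
  have hanti : Antitone fun m => polyhedron (S m) := fun m m' hm x hx q hq => hx q (hS hm hq)
  have hlim : ∀ t, 0 ≤ t → Tendsto (fun m => (P m).eval t) atTop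
      (𝓝 (vol (K + t • unitBall n))) := by
    intro t ht
    simp only [← hPe _ t ht]
    rw [vol, coe_add_smul_unitBall K ht, hK, tube_iInter hanti fun m => isClosed_polyhedron _]
    have hfin : ∀ m, volume (tube (polyhedron (S m)) t) ≠ ∞ := fun m =>
      (isBounded_tube (hb m) t).measure_lt_top.ne
    refine (ENNReal.tendsto_toReal ?_).comp (tendsto_measure_iInter_atTop (fun m => ?_)
      (fun m m' hm => ?_) ⟨0, hfin 0⟩)
    · exact ne_top_of_le_ne_top (hfin 0) (measure_mono (Set.iInter_subset _ 0))
    · obtain ⟨p, hp⟩ := exists_isNearestPoint (convex_polyhedron (S m)) (isClosed_polyhedron _)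
        (hne m)
      exact (hp.isClosed_tube t).measurableSet.nullMeasurableSet
    · rintro x ⟨k, hk, h⟩
      exact ⟨k, hanti hm hk, h⟩
  obtain ⟨Q, hQ, hQ'⟩ := exists_polynomial_of_tendsto_eval (n := n)
    (fun m => by simpa using hPd m) hlim
  exact ⟨Q, hQ, hQ'⟩

theorem isSteinerPolynomial_steinerPolynomial (K : ConvexBody (Eucl n)) :
    IsSteinerPolynomial K (unitBall n) (steinerPolynomial K (unitBall n)) := by
  have h := exists_isSteinerPolynomial K
  rw [steinerPolynomial, dif_pos h]
  exact h.choose_spec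

end Steiner

end Wills

/-! ### Hadwiger's integral formula -/

namespace Wills

section Gaussian

variable {n : ℕ}

theorem kappa_eq (n : ℕ) : kappa n = √Real.pi ^ n / Real.Gamma (n / 2 + 1) := by
  rw [kappa, vol, measureReal_def]
  change (volume (Metric.closedBall (0 : Eucl n) 1)).toReal = _
  rcases n with _ | n
  · have h : Metric.closedBall (0 : Eucl 0) 1 = Set.univ :=
      Set.eq_univ_of_forall fun x => by simp [Subsingleton.elim x 0]
    have h' := (PiLp.volume_preserving_toLp (Fin 0)).measure_preimage
      MeasurableSet.univ.nullMeasurableSet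
    rw [Set.preimage_univ] at h'
    rw [h, ← h', volume_pi, Measure.pi_of_empty (x := 0)]
    simp
  · rw [EuclideanSpace.volume_closedBall]
    have : 0 < Real.Gamma (((n + 1 : ℕ) : ℝ) / 2 + 1) := Real.Gamma_pos_of_pos (by positivity)
    rw [ENNReal.toReal_mul, ENNReal.toReal_ofReal (by positivity)]
    simp

theorem wills_eq_sum (K : ConvexBody (Eucl n)) :
    wills K = ∑ j ∈ Finset.range (n + 1), (steinerPolynomial K (unitBall n)).coeff j / kappa j := by
  rw [wills, ← Finset.sum_range_reflect]
  refine Finset.sum_congr rfl fun j hj => ?_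
  have hj' : j ≤ n := Nat.lt_succ_iff.1 (Finset.mem_range.1 hj)
  have e1 : n + 1 - 1 - j = n - j := by omega
  have e2 : n - (n - j) = j := by omega
  have hc : (n.choose j : ℝ) ≠ 0 := by exact_mod_cast (Nat.choose_pos hj').ne'
  rw [e1, intrinsicVolume, quermassintegral, e2, Nat.choose_symm hj']
  field_simp

theorem integrable_rpow_stdExp {p : ℝ} (hp : 0 ≤ p) :
    Integrable (fun s : ℝ≥0 => (s : ℝ) ^ p) stdExp := by
  refine ⟨by fun_prop, ?_⟩
  rw [hasFiniteIntegral_iff_ofReal (Filter.Eventually.of_forall fun s => by positivity),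
    lintegral_rpow_stdExp hp]
  exact ENNReal.ofReal_lt_top

theorem integral_rpow_stdExp {p : ℝ} (hp : 0 ≤ p) :
    ∫ s : ℝ≥0, (s : ℝ) ^ p ∂stdExp = Real.Gamma (p + 1) := by
  rw [integral_eq_lintegral_of_nonneg_ae (Filter.Eventually.of_forall fun s => by positivity)
    (by fun_prop), lintegral_rpow_stdExp hp,
    ENNReal.toReal_ofReal (Real.Gamma_pos_of_pos (by positivity)).le]

/-- The weight `t ↦ π t²` of the classical Wills functional. -/
noncomputable def gaussWeight (t : ℝ≥0) : EReal := ((Real.pi * (t : ℝ) ^ 2 : ℝ) : EReal)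

theorem isWeight_gaussWeight : IsWeight gaussWeight where
  ne_bot _ := EReal.coe_ne_bot _
  monotone s t hst := by
    rw [gaussWeight, gaussWeight, EReal.coe_le_coe_iff]
    have : (s : ℝ) ≤ t := hst
    gcongr
  continuousOn := by
    refine (continuous_coe_real_ereal.comp ?_).continuousOn
    fun_prop
  convex s t a b hab := by
    rw [gaussWeight, gaussWeight, gaussWeight, ← EReal.coe_mul, ← EReal.coe_mul, ← EReal.coe_add,
      EReal.coe_le_coe_iff]
    have hab' : (a : ℝ) + b = 1 := by exact_mod_cast hab
    have : (a : ℝ) = 1 - b := by linarith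
    push_cast
    have h : (a * s + b * t : ℝ) ^ 2 + a * b * (s - t : ℝ) ^ 2 = a * s ^ 2 + b * t ^ 2 := by
      rw [this]; ring
    have h2 : (0 : ℝ) ≤ a * b * (s - t : ℝ) ^ 2 := by positivity
    calc Real.pi * (a * s + b * t : ℝ) ^ 2 ≤ Real.pi * (a * s ^ 2 + b * t ^ 2) := by
          gcongr
          linarith
      _ = _ := by ring

theorem zero_mem_interior_unitBall : (0 : Eucl n) ∈ interior (unitBall n : Set (Eucl n)) :=
  Metric.ball_subset_interior_closedBall (Metric.mem_ball_self zero_lt_one)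

theorem volume_sublevel_gaussWeight (K : ConvexBody (Eucl n)) (s : ℝ≥0) :
    volume {x | gaussWeight (relDist (unitBall n) K x) ≤ ((0 + s : ℝ) : EReal)} =
      ENNReal.ofReal (vol (K + √((s : ℝ) / Real.pi) • unitBall n)) := by
  rw [vol, measureReal_def, ENNReal.ofReal_toReal (ConvexBody.isBounded _).measure_lt_top.ne]
  congr 1
  ext x
  have h := relDist_le_iff (K := K) (x := x) (t := NNReal.mk √((s : ℝ) / Real.pi) (by positivity))
    zero_mem_interior_unitBall
  refine Iff.trans ?_ h
  rw [Set.mem_ofPred_eq, gaussWeight, EReal.coe_le_coe_iff, zero_add, ← NNReal.coe_le_coe]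
  change _ ↔ _ ≤ √((s : ℝ) / Real.pi)
  rw [Real.le_sqrt (by positivity), le_div_iff₀' Real.pi_pos]
  positivity

/-- Hadwiger's integral representation of the Wills functional. -/
theorem genWills_gaussWeight (K : ConvexBody (Eucl n)) :
    0 ≤ wills K ∧ genWills gaussWeight K (unitBall n) = ENNReal.ofReal (wills K) := by
  obtain ⟨hd, he⟩ := isSteinerPolynomial_steinerPolynomial K
  set P := steinerPolynomial K (unitBall n) with hP
  have hsum : ∀ s : ℝ≥0, vol (K + √((s : ℝ) / Real.pi) • unitBall n) =
      ∑ j ∈ Finset.range (n + 1), P.coeff j / √Real.pi ^ j * (s : ℝ) ^ ((j : ℝ) / 2) := by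
    intro s
    rw [he _ (by positivity), Polynomial.eval_eq_sum_range' (Nat.lt_succ_of_le hd)]
    refine Finset.sum_congr rfl fun j _ => ?_
    rw [Real.sqrt_div s.coe_nonneg, div_pow, Real.sqrt_eq_rpow (s : ℝ), ← Real.rpow_natCast ((s : ℝ) ^ _),
      ← Real.rpow_mul s.coe_nonneg]
    ring_nf
  have hint : ∀ j ∈ Finset.range (n + 1), Integrable
      (fun s : ℝ≥0 => P.coeff j / √Real.pi ^ j * (s : ℝ) ^ ((j : ℝ) / 2)) stdExp := fun j _ =>
    (integrable_rpow_stdExp (by positivity)).const_mul _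
  -- The moment `Γ(j/2 + 1)` of `s^(j/2)`, divided by `π^(j/2)`, is exactly `1 / κ_j`.
  have hw : wills K = ∫ s : ℝ≥0, vol (K + √((s : ℝ) / Real.pi) • unitBall n) ∂stdExp := by
    simp_rw [hsum]
    rw [integral_finsetSum _ hint, wills_eq_sum]
    refine Finset.sum_congr rfl fun j _ => ?_
    rw [integral_const_mul, integral_rpow_stdExp (by positivity), kappa_eq, div_div_eq_mul_div,
      ← hP]
    ring
  refine ⟨hw ▸ integral_nonneg fun s => measureReal_nonneg, ?_⟩
  rw [genWills, lintegral_exp_neg_eq volume (f := fun x => gaussWeight (relDist (unitBall n) K x))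
    (isWeight_gaussWeight.monotone.measurable.comp (measurable_relDist zero_mem_interior_unitBall))
    (a := 0)]
  · simp_rw [volume_sublevel_gaussWeight]
    rw [hw, ofReal_integral_eq_lintegral_ofReal]
    · simp
    · simp_rw [hsum]
      exact integrable_finsetSum _ hint
    · exact Filter.Eventually.of_forall fun s => measureReal_nonneg
  · intro x
    rw [gaussWeight, EReal.coe_le_coe_iff]
    positivity

end Gaussian

end Wills

/-! ### The two inequalities -/

theorem theorem1p6 (n : ℕ) (hn : 1 ≤ n) :
    (∀ (K L : ConvexBody (Wills.Eucl n)) (l : ℝ), 0 < l → l < 1 →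
      1 / (n ! : ℝ) ^ (1 / (n : ℝ)) *
          ((1 - l) * Wills.wills K ^ (1 / (n : ℝ)) + l * Wills.wills L ^ (1 / (n : ℝ))) ≤
        Wills.wills ((1 - l) • K + l • L) ^ (1 / (n : ℝ))) ∧
    (∀ (K L E : ConvexBody (Wills.Eucl n)), (0 : Wills.Eucl n) ∈ interior (E : Set (Wills.Eucl n)) →
      ∀ u : ℝ≥0 → EReal, Wills.IsWeight u → StrictMonoOn u {t | u t ≠ ⊤} →
      ∀ l : ℝ, 0 < l → l < 1 →
      EReal.exp (-((((n : ℝ) - 1) / n : ℝ) : EReal) * max (u 0) 0) /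
            (n ! : ℝ≥0∞) ^ (1 / (n : ℝ)) *
          (ENNReal.ofReal (1 - l) * Wills.genWills u K E ^ (1 / (n : ℝ)) +
            ENNReal.ofReal l * Wills.genWills u L E ^ (1 / (n : ℝ))) ≤
        Wills.genWills u ((1 - l) • K + l • L) E ^ (1 / (n : ℝ))) := by
  have hn0 : n ≠ 0 := by omega
  have hn1 : (0 : ℝ) ≤ 1 / n := by positivity
  have hfact : (0 : ℝ) < n ! := by exact_mod_cast n.factorial_pos
  refine ⟨fun K L l h0 h1 => ?_, fun K L E hE u hu _ l h0 h1 => ?_⟩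
  · have h := Wills.genWills_brunnMinkowski hn0 Wills.isWeight_gaussWeight
      Wills.zero_mem_interior_unitBall h0 h1 K L
    have h1' : 0 ≤ 1 - l := by linarith
    obtain ⟨hK, hK'⟩ := Wills.genWills_gaussWeight K
    obtain ⟨hL, hL'⟩ := Wills.genWills_gaussWeight L
    obtain ⟨hM, hM'⟩ := Wills.genWills_gaussWeight ((1 - l) • K + l • L)
    rw [hK', hL', hM', ← ENNReal.ofReal_natCast, ENNReal.ofReal_rpow_of_nonneg hK hn1,
      ENNReal.ofReal_rpow_of_nonneg hL hn1, ENNReal.ofReal_rpow_of_nonneg hM hn1,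
      ENNReal.ofReal_rpow_of_nonneg hfact.le hn1, ← ENNReal.ofReal_mul h1',
      ← ENNReal.ofReal_mul h0.le, ← ENNReal.ofReal_mul (by positivity),
      ← ENNReal.ofReal_add (by positivity) (by positivity),
      ENNReal.ofReal_le_ofReal_iff (by positivity)] at h
    rw [one_div_mul_eq_div, div_le_iff₀' (by positivity)]
    exact h
  · have h := Wills.genWills_brunnMinkowski hn0 hu hE h0 h1 K L
    -- The exponent is non-positive, so this factor only weakens the inequality `h`.
    have hexp : EReal.exp (-((((n : ℝ) - 1) / n : ℝ) : EReal) * max (u 0) 0) ≤ 1 := by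
      rw [← EReal.exp_zero, EReal.exp_le_exp_iff, EReal.neg_mul]
      refine EReal.neg_le_of_neg_le ?_
      rw [neg_zero]
      have : (1 : ℝ) ≤ n := by exact_mod_cast hn
      exact mul_nonneg (EReal.coe_nonneg.2 (div_nonneg (by linarith) (by positivity)))
        (le_max_right _ _)
    have hN0 : (n ! : ℝ≥0∞) ^ (1 / (n : ℝ)) ≠ 0 := by
      simp [n.factorial_ne_zero]
    have hNt : (n ! : ℝ≥0∞) ^ (1 / (n : ℝ)) ≠ ∞ :=
      ENNReal.rpow_ne_top_of_nonneg hn1 (ENNReal.natCast_ne_top _)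
    calc _ ≤ 1 / (n ! : ℝ≥0∞) ^ (1 / (n : ℝ)) * ((n ! : ℝ≥0∞) ^ (1 / (n : ℝ)) *
          Wills.genWills u ((1 - l) • K + l • L) E ^ (1 / (n : ℝ))) := by gcongr
      _ = _ := by
        rw [← mul_assoc, one_div, ENNReal.inv_mul_cancel hN0 hNt, one_mul]
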